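/- **Setting.** Let $G=(V,E,\omega)$ be an undirected graph on $V=\{0,\dots,n-1\}$, $n\ge 2$, with $\omega(e)\ge 1$ for every edge. For $S\subseteq V$ let $d^{(t)}_G(v,S)$ be the least length of a path with at most $t$ edges between $v$ and a vertex of $S$ ($\infty$ if there is none). Let $\Lambda\ge 1$ be a bound known to the algorithm that is at least the aspect ratio of $G$, i.e. the maximum finite distance between two vertices. A dynamic stream is a sequence of updates (edge, sign $\pm1$, weight), of which there are at most polynomially many, $n^{a}$. At the end of the stream, the signs of the updates with edge $e$ and weight $w$ sum to $1$ if $e\in E$ and $\omega(e)=w$, and to $0$ otherwise. Different passes may present the updates differently. $\log$ is $\log_2$. Stored numbers are charged the binary length of their absolute value, rounded up to an integer, plus one bit (exact length for integer weights). **Algorithm.** Parameters: $1\le\eta\le n^{a}$, $0<\zeta\le 1$, $S\subseteq V$, $c_1>0$. Put $\zeta'=\zeta/(2\eta)$, $\lambda=\lceil\log n\rceil$, and split the search range into $I_0=[1,1+\zeta']$ and $I_j=((1+\zeta')^{j},(1+\zeta')^{j+1}]$ for $1\le j<\lceil\log_{1+\zeta'}(2\Lambda)\rceil$. Start with $\hat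 d=0$ on $S$, $\hat d=\infty$ elsewhere, and all parents $\hat p=\perp$. In each of $\eta$ passes draw $\lceil c_1\log_{8/7}n\rceil$ fresh independent hash functions $h:V\to\{1,\dots,2^\lambda\}$ from the pairwise independent family $y\mapsto\alpha y+\beta$ over the field with $2^\lambda$ elements. For all $x\in V\setminus S$, all $j$ and all $h$ keep, for each level $k=0,\dots,\lambda$, three registers, initially $0$. An update of an edge $xy$ with sign $s$ and weight $w$ such that $\hat d(y)+w\in I_j$ and $h(y)\le 2^k$ adds $s$ to the first register (count), adds $s\,(\hat d(y)+w)$ to the second (distance), and XORs the name of $y$ into the third (name). After the pass, the call for $(x,j,h)$ returns "nothing" if all its registers are $0$; otherwise it returns the distance and name of a level with count $1$ if there is one; otherwise it returns an error. The guess $(x,j)$ is the successful call with the smallest distance. If all calls of some guess return an error, the algorithm stops with an error. Otherwise, for every $x\in V\setminus S$, the guess with the smallest $j$ that returned a distance replaces $(\hat d(x),\hat p(x))$ if that distance is smaller than $\hat d(x)$ (all vertices are updated simultaneously, at the end of the pass). **Theorem.** For every $c>0$ and every $a\in\mathbb N$ there are constants $c_1,C>0$, depending only on $c$ and $a$, such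 that for all $n,G,\Lambda,S,\eta,\zeta$ and all streams for the $\eta$ passes as above: 1. With probability at least $1-n^{-c}$ the algorithm stops without an error and performs a $(1+\zeta)$-approximate Bellman–Ford exploration of $G$ rooted at $S$ to depth $\eta$, in the following sense. For every $v\in V$ we have $d^{(\eta)}_G(v,S)\le\hat d(v)$, and $$d^{(\eta)}_G(v,S)\le\hat d(v)\le(1+\zeta)\,d^{(\eta)}_G(v,S)\qquad\text{if } d^{(\eta)}_G(v,S)\le\Lambda \text{ or } d^{(\eta)}_G(v,S)=\infty$$ (so for all $v$ if $\Lambda$ is also at least every finite $d^{(\eta)}_G(v,S)$, for instance if $\Lambda\ge(n-1)\max_e\omega(e)$). Moreover $\hat d(s)=0$ and $\hat p(s)=\perp$ for $s\in S$, and $\hat p(v)=\perp$ if $\hat d(v)=\infty$. Every $v\notin S$ with $\hat d(v)<\infty$ has a parent $\hat p(v)=u$ with $uv\in E$ and $\hat d(u)+\omega(u,v)\le\hat d(v)$. From every $v$ with $\hat d(v)<\infty$ the parent pointers lead to $S$, so they form a forest rooted at $S$. 2. The algorithm makes $\eta$ passes, and for every outcome of its random choices it stores at every moment at most $$C\cdot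 n\cdot\frac{\eta}{\zeta}\cdot\log^2 n\cdot\log(2\Lambda)\cdot(\log n+\log(2\Lambda))\ \text{ bits.}$$ -/

import Mathlib

open scoped ENNReal

noncomputable section

namespace DynStream

/-! ### Weighted graphs and hop-bounded distances -/

/-- Length of a walk: the sum of the weights of its edges. -/
def walkLength {V : Type} {G : SimpleGraph V} (ω : Sym2 V → ℝ) {u v : V} (p : G.Walk u v) : ℝ :=
  (p.edges.map ω).sum

/-- The `t`-bounded distance `d^{(t)}(v, S)`: the least length of a walk with at most `t` edges
between a vertex of `S` and `v`, and `∞` if there is none. (Weights of edges are positive here, so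
walks and paths give the same infimum.) -/
def hopDist {V : Type} (G : SimpleGraph V) (ω : Sym2 V → ℝ) (t : ℕ) (S : Finset V) (v : V) :
    ℝ≥0∞ :=
  ⨅ s ∈ S, ⨅ p : G.Walk s v, ⨅ _ : p.length ≤ t, ENNReal.ofReal (walkLength ω p)

/-- The (unbounded) distance between two vertices. -/
def graphDist {V : Type} (G : SimpleGraph V) (ω : Sym2 V → ℝ) (u v : V) : ℝ≥0∞ :=
  ⨅ p : G.Walk u v, ENNReal.ofReal (walkLength ω p)

/-- The aspect ratio of a graph with weights at least `1`: the maximum finite distance. -/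
def aspectRatio {V : Type} (G : SimpleGraph V) (ω : Sym2 V → ℝ) : ℝ≥0∞ :=
  ⨆ u : V, ⨆ v : V, ⨆ _ : G.Reachable u v, graphDist G ω u v

/-! ### Dynamic streams -/

/-- One update of a weighted dynamic stream: an edge, a sign `+1` (insertion) or `-1` (removal),
and the weight of the edge. -/
structure Update (n : ℕ) where
  edge : Sym2 (Fin n)
  sign : ℤˣ
  weight : ℝ

/-- The stream `σ` describes the weighted graph `(G, ω)`: when it ends, the multiplicity of an edge
`e` with weight `w` is `1` if `e` is an edge of `G` of weight `w`, and `0` otherwise. The order of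
insertions and removals is arbitrary. -/
def Describes {n : ℕ} (σ : List (Update n)) (G : SimpleGraph (Fin n)) (ω : Sym2 (Fin n) → ℝ) :
    Prop :=
  open Classical in
  ∀ (e : Sym2 (Fin n)) (w : ℝ),
    ((σ.filter fun u => u.edge = e ∧ u.weight = w).map fun u => (u.sign : ℤ)).sum =
      if e ∈ G.edgeSet ∧ ω e = w then 1 else 0

/-! ### Multi-pass streaming algorithms -/

/-- A randomized multi-pass streaming algorithm with updates in `U` and results in `R`. All that it
keeps between two updates, or between two passes, is its state. Before each pass it draws a fresh
uniformly random element of `Coin`. `bits` is the number of bits that storing a state takes. -/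
structure StreamingAlgorithm (U R : Type) where
  Coin : Type
  finiteCoin : Finite Coin
  State : Type
  init : State
  beginPass : Coin → State → State
  step : State → U → State
  endPass : State → State
  output : State → R
  bits : State → ℕ

namespace StreamingAlgorithm

variable {U R : Type} (A : StreamingAlgorithm U R)

/-- The state after the first `p` of `η` passes; `σ p` is the sequence of updates in pass `p`. -/
def stateAfter {η : ℕ} (coins : Fin η → A.Coin) (σ : Fin η → List U) : (p : ℕ) → p ≤ η → A.State
  | 0, _ => A.init
  | p + 1, h =>
    A.endPass ((σ ⟨p, h⟩).foldl A.step
      (A.beginPass (coins ⟨p, h⟩) (stateAfter coins σ p (Nat.le_of_succ_le h))))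

/-- The state in pass `p` when `i` updates of that pass have been read. -/
def stateDuring {η : ℕ} (coins : Fin η → A.Coin) (σ : Fin η → List U) (p : Fin η) (i : ℕ) :
    A.State :=
  ((σ p).take i).foldl A.step (A.beginPass (coins p) (A.stateAfter coins σ p p.isLt.le))

/-- The result after `η` passes. -/
def result {η : ℕ} (coins : Fin η → A.Coin) (σ : Fin η → List U) : R :=
  A.output (A.stateAfter coins σ η le_rfl)

/-- At every moment of its `η` passes the algorithm stores at most `B` bits. -/
def SpaceAtMost {η : ℕ} (coins : Fin η → A.Coin) (σ : Fin η → List U) (B : ℝ) : Prop :=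
  (∀ (p : ℕ) (h : p ≤ η), (A.bits (A.stateAfter coins σ p h) : ℝ) ≤ B) ∧
    ∀ (p : Fin η) (i : ℕ), (A.bits (A.stateDuring coins σ p i) : ℝ) ≤ B

/-- The probability, over independent uniform coins for the `η` passes, that the result of the
algorithm on the passes `σ` satisfies `P`. -/
def resultProb {η : ℕ} (σ : Fin η → List U) (P : R → Prop) : ℝ :=
  (Nat.card {coins : Fin η → A.Coin // P (A.result coins σ)} : ℝ) / Nat.card (Fin η → A.Coin)

end StreamingAlgorithm

/-! ### Pairwise independent hash functions

The family of affine maps `y ↦ a * y + b` of the field with `2 ^ ⌈log₂ n⌉` elements. -/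

/-- `λ = ⌈log₂ n⌉`. -/
def logn (n : ℕ) : ℕ := Nat.clog 2 n

/-- The field with `2 ^ ⌈log₂ n⌉` elements (for `n ≥ 2`). -/
abbrev HashField (n : ℕ) : Type := GaloisField 2 (logn n)

/-- A hash function is stored as the pair `(a, b)` of its coefficients. -/
abbrev HashSeed (n : ℕ) : Type := HashField n × HashField n

/-- The field element that encodes a number `y < n`. -/
def hashCode (n y : ℕ) : HashField n :=
  (Finite.equivFin (HashField n)).symm ⟨y % Nat.card (HashField n), Nat.mod_lt _ Nat.card_pos⟩

/-- The hash value of the vertex `y`, an element of `{1, …, 2 ^ λ}`. -/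
def hashValue {n : ℕ} (h : HashSeed n) (y : Fin n) : ℕ :=
  (Finite.equivFin (HashField n) (h.1 * hashCode n y + h.2) : ℕ) + 1

/-! ### Approximate Bellman–Ford exploration -/

/-- The number of hash functions drawn in each pass, `⌈c₁ log_{8/7} n⌉`. -/
def numHash (n : ℕ) (c₁ : ℝ) : ℕ := ⌈c₁ * Real.logb (8 / 7) n⌉₊

/-- The width parameter of the sub-ranges, `ζ' = ζ / (2η)`. -/
def zeta' (η : ℕ) (ζ : ℝ) : ℝ := ζ / (2 * η)

/-- The number `γ + 1 = ⌈log_{1+ζ'} (2Λ)⌉` of sub-ranges. -/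
def numRanges (η : ℕ) (ζ Λ : ℝ) : ℕ := ⌈Real.logb (1 + zeta' η ζ) (2 * Λ)⌉₊

/-- The sub-range `I_j = ((1+ζ')^j, (1+ζ')^(j+1)]`, closed for `j = 0`. -/
def subRange (η : ℕ) (ζ : ℝ) (j : ℕ) : Set ℝ :=
  if j = 0 then Set.Icc 1 (1 + zeta' η ζ)
  else Set.Ioc ((1 + zeta' η ζ) ^ j) ((1 + zeta' η ζ) ^ (j + 1))

/-- One entry of the array `slots` of procedure GuessDistance. The name of a vertex is its number
and `xName` is a bitwise XOR of names. -/
structure Slot where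
  xCount : ℤ
  xDist : ℝ
  xName : ℕ

/-- The initial value of a slot. -/
def Slot.empty : Slot := ⟨0, 0, 0⟩

/-- The result of GuessDistance: no edge in the range; a distance and a name; or an error. -/
inductive GuessResult where
  | nothing : GuessResult
  | found (dist : ℝ) (name : ℕ) : GuessResult
  | error : GuessResult

/-- Recovery stage of GuessDistance. -/
def recover {l : ℕ} (slots : Fin l → Slot) : GuessResult :=
  open Classical in
  if ∀ k, slots k = Slot.empty then .nothing
  else match (List.finRange l).find? fun k => (slots k).xCount = 1 with
    | some k => .found (slots k).xDist (slots k).xName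
    | none => .error

/-- Combination of the parallel calls of GuessDistance for one guess: the successful call with the
smallest distance; an error if all calls return an error. -/
def combine (results : List GuessResult) : GuessResult :=
  open Classical in
  match List.argmin Prod.fst (results.filterMap fun r => match r with
      | .found d y => some (d, y)
      | _ => none) with
  | some (d, y) => .found d y
  | none => if ∀ r ∈ results, r = .error then .error else .nothing

/-- The state of the exploration: the estimates `d̂`, their shadow copies, the parents `p̂`, the
hash functions of the current pass, and for every vertex `x`, every sub-range `I_j` and every hash
function the array `slots`, with levels `0, …, λ`. -/
structure BFEState (n m r : ℕ) where
  dist : Fin n → ℝ≥0∞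
  shadow : Fin n → ℝ≥0∞
  parent : Fin n → Option (Fin n)
  hash : Fin m → HashSeed n
  slots : Fin n → Fin r → Fin m → Fin (logn n + 1) → Slot
  failed : Bool

namespace BFEState

variable {n m r : ℕ}

/-- The result of the guess of `x` for the `j`-th sub-range. -/
def guess (s : BFEState n m r) (x : Fin n) (j : Fin r) : GuessResult :=
  combine ((List.finRange m).map fun i => recover (s.slots x j i))

/-- The finite value returned by the guess of smallest index, if there is one. -/
def firstGuess (s : BFEState n m r) (x : Fin n) : Option (ℝ × ℕ) :=
  (List.finRange r).findSome? fun j => match s.guess x j with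
    | .found d y => some (d, y)
    | _ => none

/-- The first guess, if it improves on the current estimate of `x`. -/
def better (s : BFEState n m r) (x : Fin n) : Option (ℝ × ℕ) :=
  open Classical in
  (s.firstGuess x).filter fun g => ENNReal.ofReal g.1 < s.dist x

/-- Start of the exploration from `S`. -/
def start (n m r : ℕ) (S : Finset (Fin n)) : BFEState n m r where
  dist v := if v ∈ S then 0 else ⊤
  shadow v := if v ∈ S then 0 else ⊤
  parent _ := none
  hash _ := (0, 0)
  slots _ _ _ _ := Slot.empty
  failed := false

/-- Start of a phase, with freshly drawn hash functions. -/
def beginPhase (h : Fin m → HashSeed n) (s : BFEState n m r) : BFEState n m r :=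
  { s with shadow := s.dist, hash := h, slots := fun _ _ _ _ => Slot.empty }

/-- Update stage of all the calls of GuessDistance. If the edge of the update joins `x ∉ S` to `y`
and `d̂(y)` plus the weight lies in `I_j`, then for every hash function `h` the slots of all levels
`k` with `h(y) ≤ 2 ^ k` are updated. -/
def read (η : ℕ) (ζ : ℝ) (S : Finset (Fin n)) (s : BFEState n m r) (u : Update n) :
    BFEState n m r :=
  open Classical in
  { s with
    slots := fun x j i k =>
      if hx : x ∈ u.edge then
        let y := Sym2.Mem.other hx
        let d := (s.dist y).toReal + u.weight
        if x ∉ S ∧ s.dist y ≠ ⊤ ∧ d ∈ subRange η ζ j ∧ hashValue (s.hash i) y ≤ 2 ^ (k : ℕ) then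
          { xCount := (s.slots x j i k).xCount + (u.sign : ℤ)
            xDist := (s.slots x j i k).xDist + d * ((u.sign : ℤ) : ℝ)
            xName := (s.slots x j i k).xName ^^^ (y : ℕ) }
        else s.slots x j i k
      else s.slots x j i k }

/-- End of a phase: if some guess failed, the algorithm gives up; otherwise the estimates and
parents of the vertices outside `S` are updated, through the shadow copies. -/
def endPhase (S : Finset (Fin n)) (s : BFEState n m r) : BFEState n m r :=
  open Classical in
  if s.failed ∨ ∃ x ∉ S, ∃ j, s.guess x j = .error then { s with failed := true }
  else
    let newDist : Fin n → ℝ≥0∞ := fun x =>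
      if x ∈ S then s.dist x
      else match s.better x with
        | some (d, _) => ENNReal.ofReal d
        | none => s.shadow x
    { s with
      shadow := newDist
      dist := newDist
      parent := fun x =>
        if x ∈ S then s.parent x
        else match s.better x with
          | some (_, y) => if hy : y < n then some ⟨y, hy⟩ else none
          | none => s.parent x }

/-- Bits for a number: the binary length of (the integer part, rounded up, of) its absolute value,
and a sign. For integers, hence for all registers if the weights are integers, this is the exact
binary length. -/
def numBits (x : ℝ) : ℕ := Nat.size ⌈|x|⌉₊ + 1

/-- Bits for an estimate: a number and a flag for `∞`. -/
def estimateBits (d : ℝ≥0∞) : ℕ := numBits d.toReal + 1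

/-- Bits for a slot. -/
def slotBits (t : Slot) : ℕ := numBits t.xCount + numBits t.xDist + numBits t.xName

/-- The number of bits stored: estimates, shadow copies, parents (a vertex number of `λ` bits or
none) and membership in `S` for every vertex; two coefficients of `λ` bits for every hash function;
all the slots; and the failure flag. -/
def bits (s : BFEState n m r) : ℕ :=
  (∑ v, (estimateBits (s.dist v) + estimateBits (s.shadow v) + (logn n + 1) + 1)) +
    m * (2 * logn n) + (∑ x, ∑ j, ∑ i, ∑ k, slotBits (s.slots x j i k)) + 1

end BFEState

/-- The approximate Bellman–Ford exploration from `S` with hop parameter `η`, error parameter `ζ`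
and search range `[1, 2Λ]`. Its result is `none` if it terminated with an error, and otherwise the
pair of the estimates `d̂` and the parents `p̂`. -/
def bellmanFord (n η : ℕ) (ζ Λ c₁ : ℝ) (S : Finset (Fin n)) :
    StreamingAlgorithm (Update n) (Option ((Fin n → ℝ≥0∞) × (Fin n → Option (Fin n)))) where
  Coin := Fin (numHash n c₁) → HashSeed n
  finiteCoin := inferInstance
  State := BFEState n (numHash n c₁) (numRanges η ζ Λ)
  init := BFEState.start n _ _ S
  beginPass := BFEState.beginPhase
  step := BFEState.read η ζ S
  endPass := BFEState.endPhase S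
  output s := if s.failed then none else some (s.dist, s.parent)
  bits := BFEState.bits

/-! ### What the exploration has to achieve -/

/-- Following parent pointers from the vertex one arrives in `S`. -/
inductive RootedIn {V : Type} (par : V → Option V) (S : Finset V) : V → Prop
  | root (s : V) (hs : s ∈ S) : RootedIn par S s
  | step (v u : V) (hv : par v = some u) (hu : RootedIn par S u) : RootedIn par S v

/-- `dh` and `par` are the estimates and the parents of a `(1+ζ)`-approximate Bellman–Ford
exploration of `(G, ω)` to depth `η` rooted at `S`, for a search range determined by `Λ`. -/
structure IsApproxBFE {V : Type} (G : SimpleGraph V) (ω : Sym2 V → ℝ) (S : Finset V) (η : ℕ)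
    (ζ Λ : ℝ) (dh : V → ℝ≥0∞) (par : V → Option V) : Prop where
  lower : ∀ v, hopDist G ω η S v ≤ dh v
  upper : ∀ v, hopDist G ω η S v ≤ ENNReal.ofReal Λ →
    dh v ≤ ENNReal.ofReal (1 + ζ) * hopDist G ω η S v
  source : ∀ s ∈ S, dh s = 0 ∧ par s = none
  unreached : ∀ v, dh v = ⊤ → par v = none
  parent : ∀ v ∉ S, dh v ≠ ⊤ → ∃ u, par v = some u ∧ G.Adj u v ∧
    dh u + ENNReal.ofReal (ω s(u, v)) ≤ dh v
  forest : ∀ v, dh v ≠ ⊤ → RootedIn par S v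

end DynStream

end

/-!
The correctness of the exploration has a deterministic and a probabilistic half.

*Registers are linear.* A slot is the image of the stream under a homomorphism into `ℤ × ℝ × (ℕ →
ℤ/2)` (`slotVec`; XOR is addition of binary digits modulo `2`). Insertions and removals therefore
cancel (`Describes.sum_eq`), and when a pass ends, the slot of level `k` of a guess holds the sum
over those candidates `y` of the guess with `h(y) ≤ 2 ^ k` (`BFEState.slotVec_endOfPass`). Its
count is a number of vertices, so count `1` means that the other two registers belong to a single
true neighbour. Whatever the coins are, a new estimate is therefore the length of an edge plus the
estimate of its other end (`BFEState.pass_cases`), which gives the lower bound, the parents and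
the forest (`BFEState.Sound`); the latter since edges have positive weight, so that estimates
decrease along parent pointers.

*Errors are unlikely.* If a guess has `s` candidates, some level isolates exactly one of them with
probability at least `1/8` (`card_isolating_levels`). For `s ≤ 2 ^ λ / 2` this is the second
moment method at a level where between a quarter and a half of a candidate is expected; for larger
`s` every non-constant affine map that sends a candidate to the first hash value isolates it at
level `0`. Hence all `⌈c₁ log_{8/7} n⌉` calls fail with probability at most `n ^ (-c₁)`. The
number of sub-ranges is not polynomial in `n`, but a neighbour lies in at most one of them, so
that the union bound runs over the passes and the pairs of vertices only, and `c₁ = c + a + 2`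
suffices (`one_sub_le_resultProb`, `mul_pow_numHash_le`). The coins of a pass are independent of
the estimates that determine its candidates (`card_fresh_coordinate_le`).

*Upper bound.* Without errors every vertex receives, from the lowest non-empty sub-range, a value
within `1 + ζ'` of its best candidate, so after `p` passes the estimates are at most `(1 + ζ') ^
p` times the length of any walk with at most `p` edges (`BFEState.Accurate`), and `(1 + ζ') ^ η ≤
exp (ζ / 2) ≤ 1 + ζ`. As this is at most `2`, the search range up to `2 Λ` is never left along a
walk of length at most `Λ`.

*Space.* Estimates never exceed the search range, and a register receives at most `n ^ a` summands
per pass, so that every slot takes `O(log n + log (2 Λ))` bits (`BFEState.IsBounded`,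
`bits_le_of_isBounded`).
-/

noncomputable section

namespace DynStream

/-! ### Signed sums over a dynamic stream -/

/-- A signed sum over a stream that describes `(G, ω)` equals the plain sum over the edges of `G`:
updates are grouped by edge and weight, and the signs of a group add up to its multiplicity. -/
theorem Describes.sum_eq {n : ℕ} {σ : List (Update n)} {G : SimpleGraph (Fin n)}
    {ω : Sym2 (Fin n) → ℝ} (hσ : Describes σ G ω) {A : Type*} [AddCommGroup A]
    (f : Sym2 (Fin n) → ℝ → A) :
    (σ.map fun u => (u.sign : ℤ) • f u.edge u.weight).sum =
      open Classical in ∑ e, if e ∈ G.edgeSet then f e (ω e) else 0 := by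
  classical
  -- `T` contains all pairs of an edge and a weight that matter on either side.
  set T : Finset (Sym2 (Fin n) × ℝ) :=
    (σ.map fun u => (u.edge, u.weight)).toFinset ∪ Finset.univ.image fun e => (e, ω e) with hT
  have key : ∀ l : List (Update n), (∀ u ∈ l, (u.edge, u.weight) ∈ T) →
      (l.map fun u => (u.sign : ℤ) • f u.edge u.weight).sum =
        ∑ κ ∈ T, ((l.filter fun u => u.edge = κ.1 ∧ u.weight = κ.2).map
          fun u => (u.sign : ℤ)).sum • f κ.1 κ.2 := by
    intro l
    induction l with
    | nil => simp
    | cons u l ih =>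
      intro h
      rw [List.map_cons, List.sum_cons, ih fun v hv => h v (List.mem_cons_of_mem _ hv)]
      have hu : (u.sign : ℤ) • f u.edge u.weight =
          ∑ κ ∈ T, if κ = (u.edge, u.weight) then (u.sign : ℤ) • f κ.1 κ.2 else 0 := by
        rw [Finset.sum_ite_eq' T, if_pos (h u List.mem_cons_self)]
      rw [hu, ← Finset.sum_add_distrib]
      refine Finset.sum_congr rfl fun κ _ => ?_
      by_cases hκ : κ = (u.edge, u.weight)
      · subst hκ
        simp [add_smul]
      · have : ¬ (u.edge = κ.1 ∧ u.weight = κ.2) := fun h => hκ (Prod.ext h.1.symm h.2.symm)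
        simp [hκ, this]
  rw [key σ fun u hu => by
    rw [hT, Finset.mem_union, List.mem_toFinset]
    exact Or.inl (List.mem_map_of_mem (f := fun u : Update n => (u.edge, u.weight)) hu)]
  have hmult : ∀ κ ∈ T, ((σ.filter fun u => u.edge = κ.1 ∧ u.weight = κ.2).map
          fun u => (u.sign : ℤ)).sum • f κ.1 κ.2 =
      if κ.1 ∈ G.edgeSet ∧ ω κ.1 = κ.2 then f κ.1 κ.2 else 0 := by
    intro κ _
    have := hσ κ.1 κ.2
    rw [show ((σ.filter fun u => u.edge = κ.1 ∧ u.weight = κ.2).map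
          fun u => (u.sign : ℤ)).sum = if κ.1 ∈ G.edgeSet ∧ ω κ.1 = κ.2 then 1 else 0 from by
      convert this]
    split_ifs <;> simp
  rw [Finset.sum_congr rfl hmult]
  have himg : (Finset.univ.image fun e => (e, ω e)) ⊆ T := Finset.subset_union_right
  rw [← Finset.sum_subset himg, Finset.sum_image]
  · simp
  · intro e _ e' _ h
    exact (Prod.ext_iff.1 h).1
  · intro κ _ hκ
    refine if_neg fun h => hκ ?_
    exact Finset.mem_image.2 ⟨κ.1, Finset.mem_univ _, Prod.ext rfl h.2⟩

/-! ### Slots as linear sketches -/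

/-- The content of a slot as an element of an additive group in which reading an update is an
addition: names are replaced by their sequences of binary digits in `ℤ/2`, so that XOR becomes the
sum. -/
def slotVec (t : Slot) : ℤ × ℝ × (ℕ → ZMod 2) :=
  (t.xCount, t.xDist, fun b => if t.xName.testBit b then 1 else 0)

theorem slotVec_empty : slotVec Slot.empty = 0 := by
  ext <;> simp [slotVec, Slot.empty]

theorem slotVec_injective : Function.Injective slotVec := by
  rintro ⟨a, b, c⟩ ⟨a', b', c'⟩ h
  simp only [slotVec, Prod.mk.injEq] at h
  obtain ⟨rfl, rfl, h⟩ := h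
  congr
  refine Nat.eq_of_testBit_eq fun i => ?_
  have := congrFun h i
  revert this
  cases c.testBit i <;> cases c'.testBit i <;> simp

theorem slotVec_update (t : Slot) (s : ℤˣ) (d : ℝ) (y : ℕ) :
    slotVec ⟨t.xCount + (s : ℤ), t.xDist + d * ((s : ℤ) : ℝ), t.xName ^^^ y⟩ =
      slotVec t + (s : ℤ) • slotVec ⟨1, d, y⟩ := by
  ext b
  · simp [slotVec]
  · simp [slotVec, mul_comm]
  · have hneg : ((-1 : ℤ) : ZMod 2) = 1 := by decide
    have h2 : (1 : ZMod 2) + 1 = 0 := by decide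
    rcases Int.units_eq_one_or s with rfl | rfl <;>
      cases ht : t.xName.testBit b <;> cases hy : y.testBit b <;>
      simp [slotVec, ht, hy, h2]

theorem slotVec_sum_fst {ι : Type*} (B : Finset ι) (f : ι → ℝ) (g : ι → ℕ) :
    (∑ y ∈ B, slotVec ⟨1, f y, g y⟩).1 = B.card := by
  simp [Prod.fst_sum, slotVec]

/-! ### Recovery -/

section Recover

variable {n l : ℕ} {slots : Fin l → Slot} {B : Fin l → Finset (Fin n)} {f : Fin n → ℝ}

theorem slot_eq_empty_iff {t : Slot} {B : Finset (Fin n)}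
    (h : slotVec t = ∑ y ∈ B, slotVec ⟨1, f y, y⟩) : t = Slot.empty ↔ B = ∅ := by
  constructor
  · rintro rfl
    have := congrArg Prod.fst h
    rw [slotVec_sum_fst, slotVec_empty] at this
    simpa using this.symm
  · rintro rfl
    apply slotVec_injective
    rw [h, slotVec_empty, Finset.sum_empty]

theorem slot_xCount_eq {t : Slot} {B : Finset (Fin n)}
    (h : slotVec t = ∑ y ∈ B, slotVec ⟨1, f y, y⟩) : t.xCount = B.card := by
  have := congrArg Prod.fst h
  rwa [slotVec_sum_fst] at this

theorem recover_eq_nothing_iff (h : ∀ k, slotVec (slots k) = ∑ y ∈ B k, slotVec ⟨1, f y, y⟩) :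
    recover slots = .nothing ↔ ∀ k, B k = ∅ := by
  simp only [← slot_eq_empty_iff (h _)]
  unfold recover
  split_ifs with h0
  · simpa using h0
  · split <;> simpa using h0

theorem exists_of_recover_eq_found
    (h : ∀ k, slotVec (slots k) = ∑ y ∈ B k, slotVec ⟨1, f y, y⟩) {d : ℝ} {a : ℕ}
    (hr : recover slots = .found d a) : ∃ k, ∃ y ∈ B k, d = f y ∧ a = y := by
  unfold recover at hr
  split_ifs at hr with h0
  split at hr
  · rename_i k hk
    have h1 := List.find?_some hk
    have hc : (slots k).xCount = 1 := by simpa using h1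
    rw [slot_xCount_eq (h k)] at hc
    obtain ⟨y, hy⟩ := Finset.card_eq_one.1 (by exact_mod_cast hc)
    have hs : slots k = ⟨1, f y, y⟩ := by
      apply slotVec_injective
      rw [h k, hy, Finset.sum_singleton]
    refine ⟨k, y, by simp [hy], ?_⟩
    rw [hs] at hr
    injection hr with h1 h2
    exact ⟨h1.symm, h2.symm⟩
  · cases hr

theorem recover_ne_error (h : ∀ k, slotVec (slots k) = ∑ y ∈ B k, slotVec ⟨1, f y, y⟩)
    (k : Fin l) (hk : (B k).card = 1) : recover slots ≠ .error := by
  unfold recover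
  split_ifs with h0
  · simp
  · split
    · simp
    · rename_i hnone
      rw [List.find?_eq_none] at hnone
      have := hnone k (List.mem_finRange k)
      rw [slot_xCount_eq (h k), hk] at this
      simp at this

end Recover

theorem combine_eq_found {rs : List GuessResult} {d : ℝ} {a : ℕ}
    (h : combine rs = .found d a) : .found d a ∈ rs := by
  unfold combine at h
  split at h
  · rename_i d' y' heq
    have := List.argmin_mem (Option.mem_def.2 heq)
    rw [List.mem_filterMap] at this
    obtain ⟨r, hr, hr'⟩ := this
    injection h with h1 h2
    subst h1 h2
    cases r <;> simp at hr'
    obtain ⟨rfl, rfl⟩ := hr'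
    exact hr
  · split_ifs at h

theorem combine_eq_of_not_found {rs : List GuessResult}
    (h : ∀ d a, .found d a ∉ rs) :
    combine rs = open Classical in if ∀ r ∈ rs, r = .error then .error else .nothing := by
  unfold combine
  split
  · rename_i d' y' heq
    have := List.argmin_mem (Option.mem_def.2 heq)
    rw [List.mem_filterMap] at this
    obtain ⟨r, hr, hr'⟩ := this
    cases r <;> simp at hr'
    exact absurd hr (h _ _)
  · rfl

theorem combine_of_found_mem {rs : List GuessResult} {d : ℝ} {a : ℕ}
    (h : .found d a ∈ rs) : ∃ d' a', combine rs = .found d' a' := by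
  unfold combine
  split
  · exact ⟨_, _, rfl⟩
  · rename_i heq
    rw [List.argmin_eq_none, List.filterMap_eq_nil_iff] at heq
    simpa using heq _ h

/-! ### The slots at the end of a pass -/

open Classical in
/-- The neighbours `y` of `x` for which `d y + ω(x, y)` lies in the sub-range `I_j`: those among
which the guess `(x, j)` is made. -/
def candidates {n : ℕ} (G : SimpleGraph (Fin n)) (ω : Sym2 (Fin n) → ℝ) (η : ℕ) (ζ : ℝ)
    (d : Fin n → ℝ≥0∞) (x : Fin n) (j : ℕ) : Finset (Fin n) :=
  Finset.univ.filter fun y => G.Adj x y ∧ d y ≠ ⊤ ∧ (d y).toReal + ω s(x, y) ∈ subRange η ζ j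

theorem mem_candidates {n : ℕ} {G : SimpleGraph (Fin n)} {ω : Sym2 (Fin n) → ℝ} {η : ℕ} {ζ : ℝ}
    {d : Fin n → ℝ≥0∞} {x : Fin n} {j : ℕ} {y : Fin n} :
    y ∈ candidates G ω η ζ d x j ↔
      G.Adj x y ∧ d y ≠ ⊤ ∧ (d y).toReal + ω s(x, y) ∈ subRange η ζ j := by
  simp [candidates]

theorem card_hashField {n : ℕ} (hn : 2 ≤ n) : Nat.card (HashField n) = 2 ^ logn n :=
  GaloisField.card 2 _ (Nat.clog_pos one_lt_two hn).ne'

namespace BFEState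

variable {n m r η : ℕ} {ζ : ℝ} {S : Finset (Fin n)}

theorem foldl_read_fields (σ : List (Update n)) (s : BFEState n m r) :
    (σ.foldl (read η ζ S) s).dist = s.dist ∧ (σ.foldl (read η ζ S) s).shadow = s.shadow ∧
    (σ.foldl (read η ζ S) s).parent = s.parent ∧ (σ.foldl (read η ζ S) s).hash = s.hash ∧
    (σ.foldl (read η ζ S) s).failed = s.failed := by
  induction σ generalizing s with
  | nil => simp
  | cons u σ ih =>
    obtain ⟨h1, h2, h3, h4, h5⟩ := ih (read η ζ S s u)
    exact ⟨h1, h2, h3, h4, h5⟩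

open Classical in
/-- The amount that one insertion of the edge `e` with weight `w` adds to a slot of `x`. -/
def contribution (η : ℕ) (ζ : ℝ) (d : Fin n → ℝ≥0∞) (h : HashSeed n) (x : Fin n) (j k : ℕ)
    (e : Sym2 (Fin n)) (w : ℝ) : ℤ × ℝ × (ℕ → ZMod 2) :=
  ∑ y, if e = s(x, y) ∧ d y ≠ ⊤ ∧ (d y).toReal + w ∈ subRange η ζ j ∧ hashValue h y ≤ 2 ^ k then
    slotVec ⟨1, (d y).toReal + w, y⟩ else 0

theorem slotVec_read (s : BFEState n m r) (u : Update n) {x : Fin n} (hx : x ∉ S) (j : Fin r)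
    (i : Fin m) (k : Fin (logn n + 1)) :
    slotVec ((read η ζ S s u).slots x j i k) = slotVec (s.slots x j i k) +
      (u.sign : ℤ) • contribution η ζ s.dist (s.hash i) x j k u.edge u.weight := by
  classical
  simp only [read, contribution]
  by_cases hxe : x ∈ u.edge
  · have hoth := Sym2.other_spec hxe
    rw [dif_pos hxe]
    generalize Sym2.Mem.other hxe = y at hoth ⊢
    have hiff : ∀ z, u.edge = s(x, z) ↔ z = y := by
      intro z
      rw [← hoth, Sym2.congr_right]
      exact eq_comm
    simp only [hiff, ite_and, Finset.sum_ite_eq', Finset.mem_univ, if_true, hx, not_false_eq_true]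
    by_cases h1 : s.dist y ≠ ⊤ <;> by_cases h2 : (s.dist y).toReal + u.weight ∈ subRange η ζ j <;>
      by_cases h3 : hashValue (s.hash i) y ≤ 2 ^ (k : ℕ) <;>
      simp [h1, h2, h3, slotVec_update]
  · have : ∀ z, u.edge ≠ s(x, z) := fun z hz => hxe (by rw [hz]; exact Sym2.mem_mk_left _ _)
    simp [hxe, this]

theorem slotVec_foldl_read (σ : List (Update n)) (s : BFEState n m r) {x : Fin n} (hx : x ∉ S)
    (j : Fin r) (i : Fin m) (k : Fin (logn n + 1)) :
    slotVec ((σ.foldl (read η ζ S) s).slots x j i k) = slotVec (s.slots x j i k) +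
      (σ.map fun u => (u.sign : ℤ) •
        contribution η ζ s.dist (s.hash i) x j k u.edge u.weight).sum := by
  induction σ generalizing s with
  | nil => simp
  | cons u σ ih =>
    rw [List.foldl_cons, ih, slotVec_read s u hx, List.map_cons, List.sum_cons, add_assoc]
    rfl

variable {σ : List (Update n)} {G : SimpleGraph (Fin n)} {ω : Sym2 (Fin n) → ℝ}

/-- At the end of a pass a slot of `x` holds the sum over exactly those candidates whose hash
values pass the threshold of its level. -/
theorem slotVec_endOfPass (hσ : Describes σ G ω) (s : BFEState n m r) (h : Fin m → HashSeed n)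
    {x : Fin n} (hx : x ∉ S) (j : Fin r) (i : Fin m) (k : Fin (logn n + 1)) :
    slotVec ((σ.foldl (read η ζ S) (beginPhase h s)).slots x j i k) =
      ∑ y ∈ (candidates G ω η ζ s.dist x j).filter fun y => hashValue (h i) y ≤ 2 ^ (k : ℕ),
        slotVec ⟨1, (s.dist y).toReal + ω s(x, y), y⟩ := by
  classical
  rw [slotVec_foldl_read σ _ hx, hσ.sum_eq]
  change slotVec Slot.empty + (∑ e, if e ∈ G.edgeSet then
    contribution η ζ s.dist (h i) x j k e (ω e) else 0) = _
  simp only [slotVec_empty, zero_add, contribution]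
  rw [Finset.sum_filter, candidates, Finset.sum_filter]
  have : ∀ e : Sym2 (Fin n), (if e ∈ G.edgeSet then ∑ y, if e = s(x, y) ∧ s.dist y ≠ ⊤ ∧
      (s.dist y).toReal + ω e ∈ subRange η ζ j ∧ hashValue (h i) y ≤ 2 ^ (k : ℕ) then
        slotVec ⟨1, (s.dist y).toReal + ω e, y⟩ else 0 else 0) =
      ∑ y, if e = s(x, y) then (if e ∈ G.edgeSet ∧ s.dist y ≠ ⊤ ∧
      (s.dist y).toReal + ω e ∈ subRange η ζ j ∧ hashValue (h i) y ≤ 2 ^ (k : ℕ) then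
        slotVec ⟨1, (s.dist y).toReal + ω e, y⟩ else 0) else 0 := by
    intro e
    by_cases he : e ∈ G.edgeSet <;> simp [he, ite_and]
  simp only [this]
  rw [Finset.sum_comm]
  refine Finset.sum_congr rfl fun y _ => ?_
  rw [Finset.sum_ite_eq', if_pos (Finset.mem_univ _)]
  simp only [SimpleGraph.mem_edgeSet, ite_and]

/-! ### Guesses at the end of a pass -/

/-- The state after one pass over `σ` with the hash functions `h`. -/
def pass (η : ℕ) (ζ : ℝ) (S : Finset (Fin n)) (σ : List (Update n)) (s : BFEState n m r)
    (h : Fin m → HashSeed n) : BFEState n m r :=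
  endPhase S (σ.foldl (read η ζ S) (beginPhase h s))

/-- The hash functions `h` serve the guess of a vertex with candidates `A`: one of them isolates a
single element of `A` at some level. -/
def Isolates (h : Fin m → HashSeed n) (A : Finset (Fin n)) : Prop :=
  ∃ i, ∃ k : Fin (logn n + 1), (A.filter fun y => hashValue (h i) y ≤ 2 ^ (k : ℕ)).card = 1

theorem exists_of_guess_eq_found (hσ : Describes σ G ω) (s : BFEState n m r)
    (h : Fin m → HashSeed n) {x : Fin n} (hx : x ∉ S) {j : Fin r} {d : ℝ} {a : ℕ}
    (hg : (σ.foldl (read η ζ S) (beginPhase h s)).guess x j = .found d a) :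
    ∃ y ∈ candidates G ω η ζ s.dist x j, d = (s.dist y).toReal + ω s(x, y) ∧ a = y := by
  have := combine_eq_found hg
  rw [List.mem_map] at this
  obtain ⟨i, _, hi⟩ := this
  obtain ⟨k, y, hy, h1, h2⟩ :=
    exists_of_recover_eq_found (fun k => slotVec_endOfPass hσ s h hx j i k) hi
  exact ⟨y, (Finset.mem_filter.1 hy).1, h1, h2⟩

theorem hashValue_le_two_pow_logn (hn : 2 ≤ n) (h : HashSeed n) (y : Fin n) :
    hashValue h y ≤ 2 ^ logn n := by
  rw [← card_hashField hn]
  exact (Finite.equivFin (HashField n) (h.1 * hashCode n y + h.2)).isLt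

/-- If the candidates of a guess are empty, all calls return nothing. -/
theorem guess_ne_error_of_empty (hm : 0 < m) (hσ : Describes σ G ω) (s : BFEState n m r)
    (h : Fin m → HashSeed n) {x : Fin n} (hx : x ∉ S) {j : Fin r}
    (hA : candidates G ω η ζ s.dist x j = ∅) :
    (σ.foldl (read η ζ S) (beginPhase h s)).guess x j ≠ .error := by
  have hrec : ∀ i, recover ((σ.foldl (read η ζ S) (beginPhase h s)).slots x j i) = .nothing :=
    fun i => (recover_eq_nothing_iff fun k => slotVec_endOfPass hσ s h hx j i k).2 (by simp [hA])
  unfold guess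
  rw [combine_eq_of_not_found (by simp [hrec]), if_neg]
  · simp
  · intro hall
    have := hall _ (List.mem_map_of_mem (List.mem_finRange (⟨0, hm⟩ : Fin m)))
    rw [hrec] at this
    cases this

/-- A guess whose candidates are served by the hash functions returns a distance. -/
theorem exists_guess_eq_found (hn : 2 ≤ n) (hσ : Describes σ G ω) (s : BFEState n m r)
    (h : Fin m → HashSeed n) {x : Fin n} (hx : x ∉ S) {j : Fin r}
    (hA : (candidates G ω η ζ s.dist x j).Nonempty)
    (hI : Isolates h (candidates G ω η ζ s.dist x j)) :
    ∃ d a, (σ.foldl (read η ζ S) (beginPhase h s)).guess x j = .found d a := by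
  obtain ⟨i, k, hk⟩ := hI
  have h1 := recover_ne_error (fun k => slotVec_endOfPass hσ s h hx j i k) k hk
  have h2 : recover ((σ.foldl (read η ζ S) (beginPhase h s)).slots x j i) ≠ .nothing := by
    rw [Ne, recover_eq_nothing_iff fun k => slotVec_endOfPass hσ s h hx j i k]
    intro hall
    obtain ⟨y, hy⟩ := hA
    have : y ∈ (∅ : Finset (Fin n)) := by
      rw [← hall (Fin.last _)]
      exact Finset.mem_filter.2 ⟨hy, hashValue_le_two_pow_logn hn _ _⟩
    simp at this
  cases hr : recover ((σ.foldl (read η ζ S) (beginPhase h s)).slots x j i) with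
  | nothing => exact absurd hr h2
  | error => exact absurd hr h1
  | found d a =>
    refine combine_of_found_mem (d := d) (a := a) ?_
    rw [← hr]
    exact List.mem_map_of_mem (f := fun i => recover (_root_.DynStream.BFEState.slots _ x j i))
      (List.mem_finRange i)

theorem exists_of_firstGuess_eq_some {s : BFEState n m r} {x : Fin n} {g : ℝ × ℕ}
    (h : s.firstGuess x = some g) : ∃ j, s.guess x j = .found g.1 g.2 ∧
      ∀ j' < j, ∀ d a, s.guess x j' ≠ .found d a := by
  unfold firstGuess at h
  rw [List.findSome?_eq_some_iff] at h
  obtain ⟨l₁, j, l₂, hl, hj, hl₁⟩ := h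
  refine ⟨j, ?_, fun j' hj' d a hd => ?_⟩
  · cases hg : s.guess x j <;> rw [hg] at hj <;> simp at hj
    rw [← hj]
  · have hmem : j' ∈ l₁ := by
      have hsorted : (List.finRange r).Pairwise (· < ·) := List.pairwise_lt_finRange r
      have hm : j' ∈ l₁ ++ j :: l₂ := hl ▸ List.mem_finRange j'
      rw [hl, List.pairwise_append, List.pairwise_cons] at hsorted
      rcases List.mem_append.1 hm with h | h
      · exact h
      · rcases List.mem_cons.1 h with h | h
        · exact absurd h hj'.ne
        · exact absurd (hsorted.2.1.1 _ h) hj'.asymm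
    have := hl₁ _ hmem
    rw [hd] at this
    simp at this

theorem exists_firstGuess_eq_some {s : BFEState n m r} {x : Fin n} {j : Fin r} {d : ℝ} {a : ℕ}
    (h : s.guess x j = .found d a) : ∃ g, s.firstGuess x = some g := by
  unfold firstGuess
  rw [← Option.isSome_iff_exists, List.findSome?_isSome_iff]
  exact ⟨j, List.mem_finRange j, by rw [h]; rfl⟩

end BFEState

/-! ### The sub-ranges -/

section SubRange

variable {η : ℕ} {ζ : ℝ}

theorem one_lt_one_add_zeta' (hη : 1 ≤ η) (hζ : 0 < ζ) : 1 < 1 + zeta' η ζ := by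
  have : 0 < zeta' η ζ := by unfold zeta'; positivity
  linarith

theorem pow_le_of_mem_subRange {j : ℕ} {b : ℝ} (hb : b ∈ subRange η ζ j) :
    (1 + zeta' η ζ) ^ j ≤ b := by
  unfold subRange at hb
  split_ifs at hb with h
  · simpa [h] using hb.1
  · exact hb.1.le

theorem le_pow_of_mem_subRange {j : ℕ} {b : ℝ} (hb : b ∈ subRange η ζ j) :
    b ≤ (1 + zeta' η ζ) ^ (j + 1) := by
  unfold subRange at hb
  split_ifs at hb with h
  · simpa [h] using hb.2
  · exact hb.2

theorem one_le_of_mem_subRange (hη : 1 ≤ η) (hζ : 0 < ζ) {j : ℕ} {b : ℝ}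
    (hb : b ∈ subRange η ζ j) : 1 ≤ b :=
  (one_le_pow₀ (one_lt_one_add_zeta' hη hζ).le).trans (pow_le_of_mem_subRange hb)

theorem le_mul_of_mem_subRange (hη : 1 ≤ η) (hζ : 0 < ζ) {j j' : ℕ} (hj : j ≤ j') {b b' : ℝ}
    (hb : b ∈ subRange η ζ j) (hb' : b' ∈ subRange η ζ j') : b ≤ (1 + zeta' η ζ) * b' := by
  have hq := one_lt_one_add_zeta' hη hζ
  calc b ≤ (1 + zeta' η ζ) ^ (j + 1) := le_pow_of_mem_subRange hb
    _ = (1 + zeta' η ζ) * (1 + zeta' η ζ) ^ j := pow_succ' _ _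
    _ ≤ (1 + zeta' η ζ) * b' := by
      gcongr
      exact (pow_le_pow_right₀ hq.le hj).trans (pow_le_of_mem_subRange hb')

theorem subRange_eq_of_mem (hη : 1 ≤ η) (hζ : 0 < ζ) {j j' : ℕ} {b : ℝ}
    (hb : b ∈ subRange η ζ j) (hb' : b ∈ subRange η ζ j') : j = j' := by
  have hq := one_lt_one_add_zeta' hη hζ
  have key : ∀ {i i' : ℕ}, b ∈ subRange η ζ i → b ∈ subRange η ζ i' → i ≤ i' := by
    intro i i' h h'
    by_contra! hlt
    have h1 : (1 + zeta' η ζ) ^ i < b := by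
      rw [subRange, if_neg (by omega)] at h
      exact h.1
    have h2 := le_pow_of_mem_subRange h'
    have h3 := pow_le_pow_right₀ hq.le (show i' + 1 ≤ i from hlt)
    linarith
  exact le_antisymm (key hb hb') (key hb' hb)

theorem exists_mem_subRange {r : ℕ} (hr : 0 < r) {b : ℝ} (h1 : 1 ≤ b)
    (hb : b ≤ (1 + zeta' η ζ) ^ r) : ∃ j < r, b ∈ subRange η ζ j := by
  induction r with
  | zero => omega
  | succ r ih =>
    by_cases hle : 0 < r ∧ b ≤ (1 + zeta' η ζ) ^ r
    · obtain ⟨j, hj, hjb⟩ := ih hle.1 hle.2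
      exact ⟨j, by omega, hjb⟩
    · refine ⟨r, by omega, ?_⟩
      unfold subRange
      split_ifs with h
      · subst h
        exact ⟨h1, by simpa using hb⟩
      · exact ⟨by by_contra! h'; exact hle ⟨by omega, h'⟩, hb⟩

theorem numRanges_pos (hη : 1 ≤ η) (hζ : 0 < ζ) {Λ : ℝ} (hΛ : 1 ≤ Λ) : 0 < numRanges η ζ Λ :=
  Nat.ceil_pos.2 (Real.logb_pos (one_lt_one_add_zeta' hη hζ) (by linarith))

theorem two_mul_le_pow_numRanges (hη : 1 ≤ η) (hζ : 0 < ζ) {Λ : ℝ} (hΛ : 1 ≤ Λ) :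
    2 * Λ ≤ (1 + zeta' η ζ) ^ numRanges η ζ Λ := by
  have hq := one_lt_one_add_zeta' hη hζ
  rw [← Real.rpow_natCast, ← Real.logb_le_iff_le_rpow hq (by linarith)]
  exact Nat.le_ceil _

/-- All distances that the algorithm ever handles are at most `4 Λ`. -/
theorem pow_numRanges_le (hη : 1 ≤ η) (hζ : 0 < ζ) (hζ1 : ζ ≤ 1) {Λ : ℝ} (hΛ : 1 ≤ Λ) :
    (1 + zeta' η ζ) ^ numRanges η ζ Λ ≤ 4 * Λ := by
  have hq := one_lt_one_add_zeta' hη hζ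
  have hη' : (1 : ℝ) ≤ η := by exact_mod_cast hη
  have hz : zeta' η ζ ≤ 1 := by
    unfold zeta'
    rw [div_le_one (by positivity)]
    linarith
  obtain ⟨N, hN⟩ := Nat.exists_eq_add_of_lt (numRanges_pos hη hζ hΛ)
  have hlt : (N : ℝ) < Real.logb (1 + zeta' η ζ) (2 * Λ) := by
    apply Nat.lt_ceil.1
    change N < numRanges η ζ Λ
    omega
  rw [Real.lt_logb_iff_rpow_lt hq (by linarith), Real.rpow_natCast] at hlt
  rw [hN, zero_add, pow_succ]
  nlinarith

end SubRange

/-! ### The effect of one pass -/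

namespace BFEState

variable {n m r η : ℕ} {ζ : ℝ} {S : Finset (Fin n)}
  {σ : List (Update n)} {G : SimpleGraph (Fin n)} {ω : Sym2 (Fin n) → ℝ}

theorem exists_of_better_eq_some (hσ : Describes σ G ω) (s : BFEState n m r)
    (h : Fin m → HashSeed n) {x : Fin n} (hx : x ∉ S) {g : ℝ × ℕ}
    (hg : (σ.foldl (read η ζ S) (beginPhase h s)).better x = some g) :
    ∃ j : Fin r, ∃ y ∈ candidates G ω η ζ s.dist x j,
      g = ((s.dist y).toReal + ω s(x, y), (y : ℕ)) ∧ ENNReal.ofReal g.1 < s.dist x := by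
  unfold better at hg
  rw [Option.filter_eq_some_iff] at hg
  obtain ⟨hg, hlt⟩ := hg
  obtain ⟨j, hj, -⟩ := exists_of_firstGuess_eq_some hg
  obtain ⟨y, hy, h1, h2⟩ := exists_of_guess_eq_found hσ s h hx hj
  refine ⟨j, y, hy, Prod.ext h1 h2, ?_⟩
  rw [(foldl_read_fields σ (beginPhase h s)).1] at hlt
  exact of_decide_eq_true hlt

/-- Whatever the hash functions are, a pass either leaves a vertex unchanged or moves it to one of
its candidates. -/
theorem pass_cases (hσ : Describes σ G ω) (s : BFEState n m r) (h : Fin m → HashSeed n)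
    (x : Fin n) :
    ((pass η ζ S σ s h).dist x = s.dist x ∧ (pass η ζ S σ s h).parent x = s.parent x) ∨
    (x ∉ S ∧ ∃ j : Fin r, ∃ y ∈ candidates G ω η ζ s.dist x j,
      (pass η ζ S σ s h).dist x = ENNReal.ofReal ((s.dist y).toReal + ω s(x, y)) ∧
      (pass η ζ S σ s h).parent x = some y ∧ (pass η ζ S σ s h).dist x < s.dist x) := by
  obtain ⟨h1, h2, h3, -, -⟩ := foldl_read_fields (η := η) (ζ := ζ) (S := S) σ (beginPhase h s)
  unfold pass
  have hbet := fun hx g => exists_of_better_eq_some (η := η) (ζ := ζ) (S := S) hσ s h (x := x)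
    hx (g := g)
  generalize σ.foldl (read η ζ S) (beginPhase h s) = t at *
  unfold endPhase
  split_ifs with hf
  · exact Or.inl ⟨congrFun h1 x, congrFun h3 x⟩
  · by_cases hx : x ∈ S
    · exact Or.inl ⟨by simp [hx, h1, beginPhase], by simp [hx, h3, beginPhase]⟩
    · cases hb : t.better x with
      | none => exact Or.inl ⟨by simp [hx, hb, h2, beginPhase], by simp [hx, hb, h3, beginPhase]⟩
      | some g =>
        obtain ⟨j, y, hy, rfl, hlt⟩ := hbet hx g hb
        exact Or.inr ⟨hx, j, y, hy, by simp [hx, hb], by simp [hx, hb], by simpa [hx, hb] using hlt⟩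

theorem pass_shadow (s : BFEState n m r) (h : Fin m → HashSeed n) :
    (pass η ζ S σ s h).shadow = (pass η ζ S σ s h).dist := by
  obtain ⟨h1, h2, -, -, -⟩ := foldl_read_fields (η := η) (ζ := ζ) (S := S) σ (beginPhase h s)
  unfold pass
  generalize σ.foldl (read η ζ S) (beginPhase h s) = t at *
  unfold endPhase
  split_ifs
  · change t.shadow = t.dist
    rw [h1, h2]
    rfl
  · rfl

/-- If the hash functions serve all guesses that have candidates, then the pass succeeds, and every
vertex gets an estimate within `1 + ζ'` of the best that its candidates offer. -/
theorem pass_of_isolates (hn : 2 ≤ n) (hm : 0 < m) (hη : 1 ≤ η) (hζ : 0 < ζ)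
    (hσ : Describes σ G ω) (s : BFEState n m r) (h : Fin m → HashSeed n) (hs : s.failed = false)
    (hI : ∀ x ∉ S, ∀ j : Fin r, (candidates G ω η ζ s.dist x j).Nonempty →
      Isolates h (candidates G ω η ζ s.dist x j)) :
    (pass η ζ S σ s h).failed = false ∧
    ∀ x ∉ S, ∀ j : Fin r, ∀ y ∈ candidates G ω η ζ s.dist x j, (pass η ζ S σ s h).dist x ≤
      ENNReal.ofReal ((1 + zeta' η ζ) * ((s.dist y).toReal + ω s(x, y))) := by
  obtain ⟨h1, h2, -, -, h5⟩ := foldl_read_fields (η := η) (ζ := ζ) (S := S) σ (beginPhase h s)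
  have hfound := fun x (hx : x ∉ S) (j : Fin r) hA =>
    exists_guess_eq_found hn hσ s h hx hA (hI x hx j hA)
  have hempty := fun x (hx : x ∉ S) (j : Fin r) =>
    guess_ne_error_of_empty (η := η) (ζ := ζ) hm hσ s h hx (j := j)
  have hsrc := fun x (hx : x ∉ S) (j : Fin r) d a =>
    exists_of_guess_eq_found (η := η) (ζ := ζ) hσ s h hx (j := j) (d := d) (a := a)
  unfold pass
  generalize σ.foldl (read η ζ S) (beginPhase h s) = t at *
  have hnf : ¬ (t.failed = true ∨ ∃ x ∉ S, ∃ j, t.guess x j = .error) := by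
    rintro (hf | ⟨x, hx, j, hj⟩)
    · rw [h5] at hf
      simp [beginPhase, hs] at hf
    · rcases (candidates G ω η ζ s.dist x j).eq_empty_or_nonempty with hA | hA
      · exact hempty x hx j hA hj
      · obtain ⟨d, a, hd⟩ := hfound x hx j hA
        rw [hd] at hj
        cases hj
  unfold endPhase
  rw [if_neg hnf]
  refine ⟨by simp [h5, beginPhase, hs], fun x hx j y hy => ?_⟩
  obtain ⟨d, a, hd⟩ := hfound x hx j ⟨y, hy⟩
  obtain ⟨g, hg⟩ := exists_firstGuess_eq_some hd
  obtain ⟨j', hj', hmin⟩ := exists_of_firstGuess_eq_some hg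
  have hjj : j' ≤ j := not_lt.1 fun hlt => hmin j hlt _ _ hd
  obtain ⟨y', hy', hgy, -⟩ := hsrc x hx j' _ _ hj'
  have hle : g.1 ≤ (1 + zeta' η ζ) * ((s.dist y).toReal + ω s(x, y)) := by
    rw [hgy]
    exact le_mul_of_mem_subRange hη hζ hjj (mem_candidates.1 hy').2.2 (mem_candidates.1 hy).2.2
  refine le_trans ?_ (ENNReal.ofReal_le_ofReal hle)
  by_cases hlt : ENNReal.ofReal g.1 < t.dist x
  · have hb : t.better x = some g := by
      unfold better
      rw [Option.filter_eq_some_iff]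
      exact ⟨hg, by simpa using hlt⟩
    simp [hx, hb]
  · have hb : t.better x = none := by
      unfold better
      rw [hg, Option.filter_some, if_neg (by simpa using hlt)]
    have : t.shadow = t.dist := by
      rw [h1, h2]
      rfl
    simpa [hx, hb, this] using hlt

end BFEState

/-! ### Affine hashing isolates an element -/

section Affine

variable {K : Type*} [Field K] [Fintype K] [DecidableEq K]

theorem card_affine_mem (T : Finset K) (y : K) :
    (Finset.univ.filter fun p : K × K => p.1 * y + p.2 ∈ T).card = Fintype.card K * T.card := by
  rw [← Finset.card_univ, ← Finset.card_product]
  refine Finset.card_bij' (fun p _ => (p.1, p.1 * y + p.2)) (fun q _ => (q.1, q.2 - q.1 * y))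
    ?_ ?_ ?_ ?_ <;> simp

/-- Pairwise independence of the affine family. -/
theorem card_affine_mem_mem (T : Finset K) {y y' : K} (h : y ≠ y') :
    (Finset.univ.filter fun p : K × K => p.1 * y + p.2 ∈ T ∧ p.1 * y' + p.2 ∈ T).card =
      T.card * T.card := by
  have h' : y - y' ≠ 0 := sub_ne_zero.2 h
  rw [← Finset.card_product]
  refine Finset.card_bij' (fun p _ => (p.1 * y + p.2, p.1 * y' + p.2))
    (fun q _ => ((q.1 - q.2) / (y - y'), q.1 - (q.1 - q.2) / (y - y') * y)) ?_ ?_ ?_ ?_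
  · simp
  · rintro ⟨u, v⟩ huv
    rw [Finset.mem_product] at huv
    have : (u - v) / (y - y') * y' + (u - (u - v) / (y - y') * y) = v := by
      field_simp
      ring
    simp only [Finset.mem_filter, Finset.mem_univ, true_and, this]
    refine ⟨?_, huv.2⟩
    simpa using huv.1
  · rintro ⟨u, v⟩ -
    ext
    · simp only
      field_simp
      ring
    · simp only
      field_simp
      ring
  · rintro ⟨u, v⟩ -
    ext
    · simp
    · simp only
      field_simp
      ring

/-- The second moment method: if `X` elements of `A` are mapped into `T`, then `2 X - X ^ 2` is at
most the indicator of `X = 1`, and its expectation follows from pairwise independence. -/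
theorem card_isolating_ge (A T : Finset K) :
    (A.card * T.card * (Fintype.card K - A.card * T.card) : ℤ) ≤
      (Finset.univ.filter fun p : K × K =>
        (A.filter fun y => p.1 * y + p.2 ∈ T).card = 1).card := by
  set X : K × K → ℤ := fun p => ∑ y ∈ A, if p.1 * y + p.2 ∈ T then 1 else 0 with hX
  have hXcard : ∀ p, X p = (A.filter fun y => p.1 * y + p.2 ∈ T).card := fun p => by simp [hX]
  have h1 : ∑ p, X p = A.card * (Fintype.card K * T.card) := by
    rw [hX, Finset.sum_comm]
    simp only [Finset.sum_boole, card_affine_mem, Finset.sum_const]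
    simp
  have h2 : ∑ p, X p ^ 2 ≤ A.card * (Fintype.card K * T.card) + A.card ^ 2 * T.card ^ 2 := by
    have hsq : ∀ p, X p ^ 2 = ∑ y ∈ A, ∑ y' ∈ A,
        if p.1 * y + p.2 ∈ T ∧ p.1 * y' + p.2 ∈ T then 1 else 0 := by
      intro p
      rw [hX, sq, Finset.sum_mul_sum]
      refine Finset.sum_congr rfl fun y _ => Finset.sum_congr rfl fun y' _ => ?_
      rw [ite_and]
      split_ifs <;> simp
    simp only [hsq]
    rw [Finset.sum_comm]
    have hy : ∀ y ∈ A, (∑ p : K × K, ∑ y' ∈ A,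
        if p.1 * y + p.2 ∈ T ∧ p.1 * y' + p.2 ∈ T then (1 : ℤ) else 0) ≤
        Fintype.card K * T.card + A.card * T.card ^ 2 := by
      intro y hyA
      rw [Finset.sum_comm, ← Finset.add_sum_erase _ _ hyA]
      simp only [and_self, Finset.sum_boole, card_affine_mem]
      have : ∀ y' ∈ A.erase y, (((Finset.univ.filter fun p : K × K =>
          p.1 * y + p.2 ∈ T ∧ p.1 * y' + p.2 ∈ T).card : ℕ) : ℤ) = T.card ^ 2 := by
        intro y' hy'
        rw [card_affine_mem_mem T (Finset.ne_of_mem_erase hy').symm]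
        push_cast
        ring
      rw [Finset.sum_congr rfl this, Finset.sum_const, nsmul_eq_mul]
      push_cast
      gcongr
      exact Finset.erase_subset _ _
    refine (Finset.sum_le_sum hy).trans (le_of_eq ?_)
    rw [Finset.sum_const, nsmul_eq_mul]
    ring
  have h3 : ∑ p, (2 * X p - X p ^ 2) ≤
      ∑ p : K × K, if (A.filter fun y => p.1 * y + p.2 ∈ T).card = 1 then (1 : ℤ) else 0 := by
    refine Finset.sum_le_sum fun p _ => ?_
    rw [hXcard]
    generalize (A.filter fun y => p.1 * y + p.2 ∈ T).card = c
    split_ifs with h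
    · simp [h]
    · rcases Nat.lt_or_ge c 1 with h0 | h0
      · have : c = 0 := by omega
        simp [this]
      · have : (2 : ℤ) ≤ c := by exact_mod_cast (show 2 ≤ c by omega)
        nlinarith
  rw [Finset.sum_boole, Finset.sum_sub_distrib, ← Finset.mul_sum, h1] at h3
  nlinarith

/-- If the target is a single element, every non-constant affine map whose preimage of it lies in
`A` isolates. This serves the sets that contain more than half of the field, for which no level
makes the second moment small. -/
theorem card_isolating_singleton_ge (A : Finset K) (z : K) :
    (Fintype.card K - 1) * A.card ≤
      (Finset.univ.filter fun p : K × K =>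
        (A.filter fun y => p.1 * y + p.2 ∈ ({z} : Finset K)).card = 1).card := by
  have : (Fintype.card K - 1) * A.card = ((Finset.univ.erase (0 : K)) ×ˢ A).card := by
    rw [Finset.card_product, Finset.card_erase_of_mem (Finset.mem_univ _), Finset.card_univ]
  rw [this]
  refine Finset.card_le_card_of_injOn (fun q => (q.1, z - q.1 * q.2)) ?_ ?_
  · rintro ⟨a, y⟩ hq
    have hq' := Finset.mem_product.1 (Finset.mem_coe.1 hq)
    have ha : a ≠ 0 := Finset.ne_of_mem_erase hq'.1
    rw [Finset.mem_coe, Finset.mem_filter]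
    refine ⟨Finset.mem_univ _, Finset.card_eq_one.2 ⟨y, ?_⟩⟩
    ext y'
    simp only [Finset.mem_filter, Finset.mem_singleton]
    constructor
    · rintro ⟨-, h⟩
      exact mul_left_cancel₀ ha (by linear_combination h)
    · rintro rfl
      exact ⟨hq'.2, by ring⟩
  · rintro ⟨a, y⟩ hq ⟨a', y'⟩ - heq
    have ha : a ≠ 0 := Finset.ne_of_mem_erase (Finset.mem_product.1 (Finset.mem_coe.1 hq)).1
    simp only [Prod.mk.injEq] at heq
    obtain ⟨rfl, h⟩ := heq
    rw [mul_left_cancel₀ ha (sub_right_injective h)]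

/-- For nested targets of sizes `1, 2, 4, …, |K|`, at least `1/8` of the affine maps isolate an
element of `A` at some level. If `|A| ≤ |K| / 2`, this happens at the level whose target has size
between `|K| / (4 |A|)` and `|K| / (2 |A|)`; otherwise at the lowest level. -/
theorem card_isolating_levels {l : ℕ} (hl : 0 < l) (hK : Fintype.card K = 2 ^ l)
    (T : ℕ → Finset K) (hT : ∀ k ≤ l, (T k).card = 2 ^ k) {A : Finset K} (hA : A.Nonempty) :
    2 ^ l * 2 ^ l ≤ 8 * (Finset.univ.filter fun p : K × K =>
        ∃ k ≤ l, (A.filter fun y => p.1 * y + p.2 ∈ T k).card = 1).card := by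
  have hmono : ∀ k ≤ l, (Finset.univ.filter fun p : K × K =>
        (A.filter fun y => p.1 * y + p.2 ∈ T k).card = 1).card ≤
      (Finset.univ.filter fun p : K × K =>
        ∃ k ≤ l, (A.filter fun y => p.1 * y + p.2 ∈ T k).card = 1).card := by
    intro k hk
    refine Finset.card_le_card fun p hp => ?_
    rw [Finset.mem_filter] at hp ⊢
    exact ⟨hp.1, k, hk, hp.2⟩
  have hApos := hA.card_pos
  obtain ⟨l', rfl⟩ : ∃ l', l = l' + 1 := ⟨l - 1, by omega⟩
  by_cases hs : A.card ≤ 2 ^ l'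
  · have hi1 : A.card ≤ 2 ^ Nat.clog 2 A.card := Nat.le_pow_clog one_lt_two _
    have hi2 : 2 ^ Nat.clog 2 A.card < 2 * A.card := by
      rcases Nat.lt_or_ge 1 A.card with h | h
      · have := Nat.pow_pred_clog_lt_self one_lt_two h
        have hpos := Nat.clog_pos one_lt_two h
        obtain ⟨q, hq⟩ : ∃ q, Nat.clog 2 A.card = q + 1 := ⟨Nat.clog 2 A.card - 1, by omega⟩
        rw [hq, Nat.pred_succ] at this
        rw [hq, pow_succ]
        omega
      · have : A.card = 1 := by omega
        simp [this]
    have hi3 : Nat.clog 2 A.card ≤ l' := Nat.clog_le_of_le_pow hs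
    set i := Nat.clog 2 A.card
    obtain ⟨k, rfl⟩ : ∃ k, l' = i + k := ⟨l' - i, by omega⟩
    refine le_trans ?_ (Nat.mul_le_mul_left 8 (hmono k (by omega)))
    have hge := card_isolating_ge A (T k)
    rw [hT k (by omega), hK] at hge
    rw [← Nat.cast_le (α := ℤ), Nat.cast_mul 8]
    refine le_trans ?_ (mul_le_mul_of_nonneg_left hge (by norm_num))
    have e1 : ((A.card : ℤ)) ≤ 2 ^ i := by exact_mod_cast hi1
    have e2 : (2 : ℤ) ^ i ≤ 2 * A.card := by exact_mod_cast hi2.le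
    have hkpos : (0 : ℤ) < 2 ^ k := by positivity
    have e3 : (A.card : ℤ) * 2 ^ k ≤ 2 ^ i * 2 ^ k := by gcongr
    have e4 : (2 : ℤ) ^ i * 2 ^ k ≤ 2 * A.card * 2 ^ k := by gcongr
    push_cast
    rw [pow_succ, pow_add]
    nlinarith
  · refine le_trans ?_ (Nat.mul_le_mul_left 8 (hmono 0 (by omega)))
    obtain ⟨z, hz⟩ := Finset.card_eq_one.1 (hT 0 (by omega))
    rw [hz]
    refine le_trans ?_ (Nat.mul_le_mul_left 8 (card_isolating_singleton_ge A z))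
    rw [hK, pow_succ]
    have h1 : 1 ≤ 2 ^ l' := Nat.one_le_two_pow
    obtain ⟨N, hN⟩ : ∃ N, 2 ^ l' = N + 1 := ⟨2 ^ l' - 1, by omega⟩
    rw [hN] at hs ⊢
    have : (N + 1) * 2 - 1 = 2 * N + 1 := by omega
    rw [this]
    nlinarith

end Affine

/-! ### The failure probability of a guess -/

variable {n : ℕ}

theorem hashCode_injective (hn : 2 ≤ n) : Function.Injective fun y : Fin n => hashCode n y := by
  intro y y' h
  have hle : n ≤ Nat.card (HashField n) := card_hashField hn ▸ Nat.le_pow_clog one_lt_two n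
  have := (Finite.equivFin (HashField n)).symm.injective h
  rw [Fin.mk.injEq, Nat.mod_eq_of_lt (y.isLt.trans_le hle),
    Nat.mod_eq_of_lt (y'.isLt.trans_le hle)] at this
  exact Fin.ext this

/-- A single hash function fails to isolate an element of `A` at all levels with probability at most
`7/8`. -/
theorem card_not_isolating_le (hn : 2 ≤ n) {A : Finset (Fin n)} (hA : A.Nonempty) :
    8 * Nat.card {h : HashSeed n // ∀ k : Fin (logn n + 1),
      (A.filter fun y => hashValue h y ≤ 2 ^ (k : ℕ)).card ≠ 1} ≤ 7 * Nat.card (HashSeed n) := by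
  classical
  have := Fintype.ofFinite (HashField n)
  have hl : 0 < logn n := Nat.clog_pos one_lt_two hn
  have hcard := card_hashField hn
  set e := Finite.equivFin (HashField n) with he
  set T : ℕ → Finset (HashField n) := fun k => Finset.univ.filter fun z => (e z : ℕ) < 2 ^ k
    with hTdef
  have hT : ∀ k ≤ logn n, (T k).card = 2 ^ k := by
    intro k hk
    have h2 : 2 ^ k ≤ Nat.card (HashField n) := hcard ▸ Nat.pow_le_pow_right two_pos hk
    have : T k = (Finset.univ.filter fun a : Fin (Nat.card (HashField n)) => (a : ℕ) < 2 ^ k).map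
        e.symm.toEmbedding := by
      ext z
      simp [hTdef]
    rw [this, Finset.card_map, Fin.card_filter_val_lt, min_eq_right h2]
  have hmain : 2 ^ logn n * 2 ^ logn n ≤ 8 * Nat.card {h : HashSeed n // ∃ k ≤ logn n,
      ((A.image fun y : Fin n => hashCode n y).filter fun z =>
        h.1 * z + h.2 ∈ T k).card = 1} := by
    rw [Nat.card_eq_fintype_card, Fintype.card_subtype]
    convert card_isolating_levels hl (by rw [← Nat.card_eq_fintype_card, hcard]) T hT
      (hA.image fun y : Fin n => hashCode n y)
  have hiff : ∀ h : HashSeed n, (∀ k : Fin (logn n + 1),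
      (A.filter fun y => hashValue h y ≤ 2 ^ (k : ℕ)).card ≠ 1) ↔
      ¬ ∃ k ≤ logn n, ((A.image fun y : Fin n => hashCode n y).filter fun z =>
        h.1 * z + h.2 ∈ T k).card = 1 := by
    intro h
    have hc : ∀ k : ℕ, ((A.image fun y : Fin n => hashCode n y).filter fun z =>
        h.1 * z + h.2 ∈ T k).card = (A.filter fun y => hashValue h y ≤ 2 ^ k).card := by
      intro k
      rw [Finset.filter_image, Finset.card_image_of_injective _ (hashCode_injective hn)]
      congr 1
      refine Finset.filter_congr fun y _ => ?_
      simp [hTdef, hashValue, he]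
    simp only [hc]
    push Not
    exact ⟨fun H k hk => H ⟨k, by omega⟩, fun H k => H k (by omega)⟩
  have hsplit := Nat.card_congr (Equiv.sumCompl fun h : HashSeed n => ∃ k ≤ logn n,
    ((A.image fun y : Fin n => hashCode n y).filter fun z => h.1 * z + h.2 ∈ T k).card = 1)
  rw [Nat.card_sum, Nat.card_prod, hcard] at hsplit
  rw [Nat.card_congr (Equiv.subtypeEquivRight hiff), Nat.card_prod, hcard]
  omega

/-- Independent hash functions: the failure probabilities multiply. -/
theorem card_not_isolates_le (hn : 2 ≤ n) (m : ℕ) {A : Finset (Fin n)} (hA : A.Nonempty) :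
    (Nat.card {h : Fin m → HashSeed n // ¬ BFEState.Isolates h A} : ℝ) ≤
      (7 / 8) ^ m * Nat.card (Fin m → HashSeed n) := by
  have e : {h : Fin m → HashSeed n // ¬ BFEState.Isolates h A} ≃
      (Fin m → {h : HashSeed n // ∀ k : Fin (logn n + 1),
        (A.filter fun y => hashValue h y ≤ 2 ^ (k : ℕ)).card ≠ 1}) :=
    (Equiv.subtypeEquivRight fun h => by unfold BFEState.Isolates; push Not; rfl).trans
      (Equiv.subtypePiEquivPi (p := fun _ h => ∀ k : Fin (logn n + 1),
        (A.filter fun y => hashValue h y ≤ 2 ^ (k : ℕ)).card ≠ 1))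
  rw [Nat.card_congr e, Nat.card_fun, Nat.card_fun, Nat.card_fin]
  push_cast
  rw [← mul_pow]
  gcongr
  have := card_not_isolating_le hn hA
  have h' : (8 : ℝ) * Nat.card {h : HashSeed n // ∀ k : Fin (logn n + 1),
      (A.filter fun y => hashValue h y ≤ 2 ^ (k : ℕ)).card ≠ 1} ≤ 7 * Nat.card (HashSeed n) := by
    exact_mod_cast this
  linarith

/-! ### Hop-bounded distances -/

section HopDist

variable {n : ℕ} {G : SimpleGraph (Fin n)} {ω : Sym2 (Fin n) → ℝ} {S : Finset (Fin n)}

theorem walkLength_concat {u v w : Fin n} (p : G.Walk u v) (h : G.Adj v w) :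
    walkLength ω (p.concat h) = walkLength ω p + ω s(v, w) := by
  simp [walkLength, SimpleGraph.Walk.edges_concat]

theorem walkLength_nonneg (hω : ∀ e ∈ G.edgeSet, 1 ≤ ω e) {u v : Fin n} (p : G.Walk u v) :
    0 ≤ walkLength ω p := by
  refine List.sum_nonneg fun a ha => ?_
  obtain ⟨e, he, rfl⟩ := List.mem_map.1 ha
  linarith [hω e (p.edges_subset_edgeSet he)]

theorem hopDist_le_of_walk {t : ℕ} {a v : Fin n} (ha : a ∈ S) (p : G.Walk a v)
    (hp : p.length ≤ t) : hopDist G ω t S v ≤ ENNReal.ofReal (walkLength ω p) :=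
  iInf_le_of_le a <| iInf_le_of_le ha <| iInf_le_of_le p <| iInf_le_of_le hp le_rfl

/-- A finite hop-bounded distance is attained, as there are only finitely many walks with a given
number of edges. -/
theorem exists_walk_of_hopDist_ne_top {t : ℕ} {v : Fin n} (h : hopDist G ω t S v ≠ ⊤) :
    ∃ a ∈ S, ∃ p : G.Walk a v, p.length ≤ t ∧
      hopDist G ω t S v = ENNReal.ofReal (walkLength ω p) := by
  classical
  have hfin : ∀ a : Fin n, Finite {p : G.Walk a v // p.length ≤ t} := by
    intro a
    refine Set.Finite.subset (Finset.finite_toSet (G.finsetWalkLengthLT (t + 1) a v))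
      (s := _) (t := {p : G.Walk a v | p.length ≤ t}) fun p hp => ?_
    rw [Finset.mem_coe, SimpleGraph.mem_finsetWalkLengthLT_iff]
    exact Nat.lt_succ_of_le hp
  set I := Σ a : S, {p : G.Walk (a : Fin n) v // p.length ≤ t}
  have hI : hopDist G ω t S v = ⨅ i : I, ENNReal.ofReal (walkLength ω i.2.1) := by
    rw [iInf_sigma, hopDist, iInf_subtype']
    refine iInf_congr fun a => ?_
    rw [iInf_subtype]
  have hne : Nonempty I := by
    by_contra hne
    rw [not_nonempty_iff] at hne
    exact h (by rw [hI, iInf_of_empty])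
  obtain ⟨i, hi⟩ := exists_eq_ciInf_of_finite (f := fun i : I => ENNReal.ofReal
    (walkLength ω i.2.1))
  exact ⟨i.1, i.1.2, i.2.1, i.2.2, by rw [hI, ← hi]⟩

theorem hopDist_mono {t t' : ℕ} (h : t ≤ t') (v : Fin n) :
    hopDist G ω t' S v ≤ hopDist G ω t S v :=
  le_iInf₂ fun _ ha => le_iInf₂ fun p hp => hopDist_le_of_walk ha p (hp.trans h)

theorem hopDist_succ_le (hω : ∀ e ∈ G.edgeSet, 1 ≤ ω e) {t : ℕ} {x y : Fin n} (h : G.Adj x y) :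
    hopDist G ω (t + 1) S x ≤ hopDist G ω t S y + ENNReal.ofReal (ω s(x, y)) := by
  by_cases htop : hopDist G ω t S y = ⊤
  · simp [htop]
  obtain ⟨a, ha, p, hp, heq⟩ := exists_walk_of_hopDist_ne_top htop
  have hxy := hω s(x, y) h
  rw [heq, ← ENNReal.ofReal_add (walkLength_nonneg hω p) (by linarith), Sym2.eq_swap,
    ← walkLength_concat p h.symm]
  exact hopDist_le_of_walk ha _ (by simpa using hp)

end HopDist

/-! ### Correctness of a run -/

theorem one_add_zeta'_pow_le {η : ℕ} {ζ : ℝ} (hη : 1 ≤ η) (hζ : 0 < ζ) (hζ1 : ζ ≤ 1) {p : ℕ}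
    (hp : p ≤ η) : (1 + zeta' η ζ) ^ p ≤ 1 + ζ := by
  have hη' : (0 : ℝ) < η := by exact_mod_cast hη
  have hq := one_lt_one_add_zeta' hη hζ
  calc (1 + zeta' η ζ) ^ p ≤ (1 + zeta' η ζ) ^ η := pow_le_pow_right₀ hq.le hp
    _ ≤ Real.exp (zeta' η ζ) ^ η := by
      gcongr
      rw [add_comm]
      exact Real.add_one_le_exp _
    _ = Real.exp (ζ / 2) := by
      rw [← Real.exp_nat_mul]
      congr 1
      unfold zeta'
      field_simp
    _ ≤ 1 + ζ := by
      -- `exp (ζ / 2) ≤ 1 / (1 - ζ / 2) ≤ 1 + ζ`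
      have h1 : 1 - ζ / 2 ≤ Real.exp (-(ζ / 2)) := Real.one_sub_le_exp_neg _
      have h2 : Real.exp (ζ / 2) * Real.exp (-(ζ / 2)) = 1 := by rw [← Real.exp_add]; simp
      have h3 := Real.exp_pos (ζ / 2)
      nlinarith [mul_le_mul_of_nonneg_left h1 h3.le]

namespace BFEState

variable {n m r η : ℕ} {ζ : ℝ} {S : Finset (Fin n)}
  {σ : List (Update n)} {G : SimpleGraph (Fin n)} {ω : Sym2 (Fin n) → ℝ}

/-- What holds after `p` passes for all hash functions. -/
structure Sound (G : SimpleGraph (Fin n)) (ω : Sym2 (Fin n) → ℝ) (S : Finset (Fin n)) (p : ℕ)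
    (s : BFEState n m r) : Prop where
  lower : ∀ v, hopDist G ω p S v ≤ s.dist v
  source : ∀ v ∈ S, s.dist v = 0 ∧ s.parent v = none
  unreached : ∀ v, s.dist v = ⊤ → s.parent v = none
  parent : ∀ v ∉ S, s.dist v ≠ ⊤ → ∃ u, s.parent v = some u ∧ G.Adj u v ∧
    s.dist u + ENNReal.ofReal (ω s(u, v)) ≤ s.dist v

theorem sound_start : Sound G ω S 0 (start n m r S) where
  lower v := by
    by_cases hv : v ∈ S
    · refine (hopDist_le_of_walk hv (SimpleGraph.Walk.nil : G.Walk v v) le_rfl).trans ?_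
      simp [walkLength]
    · simp [start, hv]
  source v hv := by simp [start, hv]
  unreached v _ := rfl
  parent v hv h := absurd (by simp [start, hv]) h

theorem pass_dist_le (hσ : Describes σ G ω) (s : BFEState n m r) (h : Fin m → HashSeed n)
    (x : Fin n) : (pass η ζ S σ s h).dist x ≤ s.dist x := by
  rcases pass_cases (η := η) (ζ := ζ) (S := S) hσ s h x with h | ⟨-, -, -, -, -, -, h⟩
  · exact h.1.le
  · exact h.le

theorem Sound.pass (hω : ∀ e ∈ G.edgeSet, 1 ≤ ω e) (hσ : Describes σ G ω) {p : ℕ}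
    {s : BFEState n m r} (hs : Sound G ω S p s) (h : Fin m → HashSeed n) :
    Sound G ω S (p + 1) (pass η ζ S σ s h) := by
  have hcases := pass_cases (η := η) (ζ := ζ) (S := S) hσ s h
  have hle := pass_dist_le (η := η) (ζ := ζ) (S := S) hσ s h
  generalize BFEState.pass η ζ S σ s h = s' at *
  have hadd : ∀ x y : Fin n, G.Adj x y → s.dist y ≠ ⊤ →
      ENNReal.ofReal ((s.dist y).toReal + ω s(x, y)) =
        s.dist y + ENNReal.ofReal (ω s(x, y)) := by
    intro x y hxy hy
    have := hω s(x, y) hxy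
    rw [ENNReal.ofReal_add ENNReal.toReal_nonneg (by linarith), ENNReal.ofReal_toReal hy]
  constructor
  · intro x
    rcases hcases x with h | ⟨-, j, y, hy, h1, -, -⟩
    · rw [h.1]
      exact (hopDist_mono (Nat.le_succ p) x).trans (hs.lower x)
    · rw [mem_candidates] at hy
      rw [h1, hadd x y hy.1 hy.2.1]
      exact (hopDist_succ_le hω hy.1).trans (add_le_add_left (hs.lower y) _)
  · intro x hx
    rcases hcases x with h | h
    · rw [h.1, h.2]
      exact hs.source x hx
    · exact absurd hx h.1
  · intro x hx
    rcases hcases x with h | ⟨-, j, y, hy, h1, -, -⟩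
    · rw [h.2]
      exact hs.unreached x (h.1 ▸ hx)
    · rw [h1] at hx
      exact absurd hx ENNReal.ofReal_ne_top
  · intro x hx htop
    rcases hcases x with h | ⟨-, j, y, hy, h1, h2, -⟩
    · rw [h.1] at htop ⊢
      rw [h.2]
      obtain ⟨u, h1, h2, h3⟩ := hs.parent x hx htop
      exact ⟨u, h1, h2, (add_le_add_left (hle u) _).trans h3⟩
    · rw [mem_candidates] at hy
      refine ⟨y, h2, hy.1.symm, ?_⟩
      rw [h1, hadd x y hy.1 hy.2.1, Sym2.eq_swap]
      exact add_le_add_left (hle y) _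

/-- What holds after `p` passes if the hash functions served all guesses: no failure, and the
estimates are within `(1 + ζ') ^ p` of the lengths of walks with at most `p` edges. -/
structure Accurate (G : SimpleGraph (Fin n)) (ω : Sym2 (Fin n) → ℝ) (S : Finset (Fin n)) (η : ℕ)
    (ζ Λ : ℝ) (p : ℕ) (s : BFEState n m r) : Prop where
  failed : s.failed = false
  upper : ∀ (a v : Fin n) (w : G.Walk a v), a ∈ S → w.length ≤ p → walkLength ω w ≤ Λ →
    s.dist v ≤ ENNReal.ofReal ((1 + zeta' η ζ) ^ p * walkLength ω w)

theorem accurate_start (Λ : ℝ) : Accurate G ω S η ζ Λ 0 (start n m r S) where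
  failed := rfl
  upper a v w ha hw _ := by
    obtain rfl := SimpleGraph.Walk.eq_of_length_eq_zero (Nat.le_zero.1 hw)
    simp [start, ha]

/-- One more edge costs one more factor `1 + ζ'`. As `(1 + ζ') ^ η ≤ 2`, the search range up to
`2 Λ` contains the values that matter. -/
theorem Accurate.pass (hn : 2 ≤ n) (hm : 0 < m) (hη : 1 ≤ η) (hζ : 0 < ζ) (hζ1 : ζ ≤ 1) {Λ : ℝ}
    (hΛ : 1 ≤ Λ) (hω : ∀ e ∈ G.edgeSet, 1 ≤ ω e) (hσ : Describes σ G ω) {p : ℕ} (hp : p ≤ η)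
    {s : BFEState n m (numRanges η ζ Λ)} (hs : Sound G ω S p s)
    (hs' : Accurate G ω S η ζ Λ p s) (h : Fin m → HashSeed n)
    (hI : ∀ x ∉ S, ∀ j : Fin (numRanges η ζ Λ), (candidates G ω η ζ s.dist x j).Nonempty →
      Isolates h (candidates G ω η ζ s.dist x j)) :
    Accurate G ω S η ζ Λ (p + 1) (pass η ζ S σ s h) := by
  obtain ⟨hf, hupper⟩ := pass_of_isolates hn hm hη hζ hσ s h hs'.failed hI
  have hsource := (hs.pass (η := η) (ζ := ζ) hω hσ h).source
  refine ⟨hf, fun a v w ha => ?_⟩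
  by_cases hvS : v ∈ S
  · intro _ _
    simp [(hsource v hvS).1]
  have hq := one_lt_one_add_zeta' hη hζ
  have hqp := one_add_zeta'_pow_le hη hζ hζ1 hp
  cases w using SimpleGraph.Walk.concatRec with
  | Hnil => exact absurd ha hvS
  | @Hconcat _ y _ w hadj =>
    intro hlen hlenΛ
    rw [walkLength_concat] at hlenΛ ⊢
    have hw0 := walkLength_nonneg hω w
    have hω1 := hω s(y, v) hadj
    have hy := hs'.upper a y w ha (by simpa using hlen) (by linarith)
    have htop : s.dist y ≠ ⊤ := ne_top_of_le_ne_top ENNReal.ofReal_ne_top hy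
    have hreal : (s.dist y).toReal ≤ (1 + zeta' η ζ) ^ p * walkLength ω w :=
      ENNReal.toReal_le_of_le_ofReal (by positivity) hy
    have hq1 : 1 ≤ (1 + zeta' η ζ) ^ p := one_le_pow₀ hq.le
    have hb : (s.dist y).toReal + ω s(y, v) ≤
        (1 + zeta' η ζ) ^ p * (walkLength ω w + ω s(y, v)) := by nlinarith
    obtain ⟨j, hj, hmem⟩ := exists_mem_subRange (η := η) (ζ := ζ) (numRanges_pos hη hζ hΛ)
      (b := (s.dist y).toReal + ω s(y, v))
      (by linarith [ENNReal.toReal_nonneg (a := s.dist y)])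
      ((hb.trans (by nlinarith)).trans (two_mul_le_pow_numRanges hη hζ hΛ))
    refine (hupper v hvS ⟨j, hj⟩ y (mem_candidates.2 ⟨hadj.symm, htop, ?_⟩)).trans ?_
    · rwa [Sym2.eq_swap]
    · rw [Sym2.eq_swap]
      refine ENNReal.ofReal_le_ofReal ?_
      rw [pow_succ', mul_assoc]
      gcongr

theorem isApproxBFE_of_sound_of_accurate (hη : 1 ≤ η) (hζ : 0 < ζ) (hζ1 : ζ ≤ 1) {Λ : ℝ}
    (hΛ : 1 ≤ Λ) (hω : ∀ e ∈ G.edgeSet, 1 ≤ ω e) {s : BFEState n m r} (hs : Sound G ω S η s)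
    (hs' : Accurate G ω S η ζ Λ η s) : IsApproxBFE G ω S η ζ Λ s.dist s.parent where
  lower := hs.lower
  upper v hv := by
    obtain ⟨a, ha, w, hw, heq⟩ := exists_walk_of_hopDist_ne_top
      (ne_top_of_le_ne_top ENNReal.ofReal_ne_top hv)
    rw [heq, ENNReal.ofReal_le_ofReal_iff (by linarith)] at hv
    rw [heq, ← ENNReal.ofReal_mul (by linarith)]
    refine (hs'.upper a v w ha hw hv).trans (ENNReal.ofReal_le_ofReal ?_)
    exact mul_le_mul_of_nonneg_right (one_add_zeta'_pow_le hη hζ hζ1 le_rfl)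
      (walkLength_nonneg hω w)
  source := hs.source
  unreached := hs.unreached
  parent := hs.parent
  forest v hv := by
    -- Estimates strictly decrease along parent pointers.
    have hwf : WellFounded fun u v : Fin n => s.dist u < s.dist v :=
      @Finite.wellFounded_of_trans_of_irrefl _ _ _ ⟨fun _ _ _ => lt_trans⟩ ⟨fun _ => lt_irrefl _⟩
    induction v using hwf.induction with
    | _ v ih =>
      by_cases hvS : v ∈ S
      · exact .root v hvS
      · obtain ⟨u, h1, h2, h3⟩ := hs.parent v hvS hv
        have hu : s.dist u ≠ ⊤ := ne_top_of_le_ne_top hv (le_self_add.trans h3)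
        have hpos : ENNReal.ofReal (ω s(u, v)) ≠ 0 := by
          have := hω s(u, v) h2
          rw [Ne, ENNReal.ofReal_eq_zero]
          linarith
        exact .step v u h1 (ih u ((ENNReal.lt_add_right hu hpos).trans_le h3) hu)

end BFEState

/-! ### The probability of success -/

/-- If a condition on a random function `f` is, for every fixed value of the other coordinates,
satisfied by at most a fraction `ε` of the values of `f p`, then it has probability at most `ε`.
The pairs `(f, c)` and `(Function.update f p c, f p)` are counted in two ways. -/
theorem card_fresh_coordinate_le {ι C : Type*} [Finite ι] [Finite C] [Nonempty C] [DecidableEq ι]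
    (p : ι) (Q : (ι → C) → C → Prop) (hQ : ∀ f c c', Q (Function.update f p c) c' ↔ Q f c')
    {ε : ℝ} (hε : ∀ f, (Nat.card {c // Q f c} : ℝ) ≤ ε * Nat.card C) :
    (Nat.card {f : ι → C // Q f (f p)} : ℝ) ≤ ε * Nat.card (ι → C) := by
  classical
  have := Fintype.ofFinite ι
  have := Fintype.ofFinite C
  have e : {f : ι → C // Q f (f p)} × C ≃ Σ f : ι → C, {c // Q f c} :=
    { toFun := fun x => ⟨Function.update x.1.1 p x.2, x.1.1 p, (hQ _ _ _).2 x.1.2⟩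
      invFun := fun x => (⟨Function.update x.1 p x.2.1, by
        rw [hQ, Function.update_self]; exact x.2.2⟩, x.1 p)
      left_inv := by
        rintro ⟨⟨f, hf⟩, c⟩
        simp
      right_inv := by
        rintro ⟨f, c, hc⟩
        refine Sigma.ext (by simp) ?_
        refine (Subtype.heq_iff_coe_eq ?_).2 (by simp)
        simp }
  have hcard := Nat.card_congr e
  rw [Nat.card_prod, Nat.card_sigma] at hcard
  have hC : (0 : ℝ) < Nat.card C := by exact_mod_cast Nat.card_pos
  refine le_of_mul_le_mul_right ?_ hC
  calc (Nat.card {f : ι → C // Q f (f p)} : ℝ) * Nat.card C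
      = ∑ f : ι → C, (Nat.card {c // Q f c} : ℝ) := by exact_mod_cast hcard
    _ ≤ ∑ _f : ι → C, ε * Nat.card C := Finset.sum_le_sum fun f _ => hε f
    _ = ε * Nat.card (ι → C) * Nat.card C := by
      rw [Finset.sum_const, nsmul_eq_mul, Finset.card_univ, ← Nat.card_eq_fintype_card]
      ring

theorem card_exists_le_sum {ι α : Type*} [Fintype ι] [Finite α] (P : ι → α → Prop) :
    (Nat.card {x : α // ∃ i, P i x} : ℝ) ≤ ∑ i, (Nat.card {x : α // P i x} : ℝ) := by
  classical
  have := Fintype.ofFinite α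
  simp only [Nat.card_eq_fintype_card, Fintype.card_subtype]
  have : (Finset.univ.filter fun x : α => ∃ i, P i x) =
      Finset.univ.biUnion fun i => Finset.univ.filter fun x => P i x := by
    ext x
    simp
  rw [this]
  exact_mod_cast Finset.card_biUnion_le

variable {n η : ℕ} {ζ Λ c₁ : ℝ} {S : Finset (Fin n)}

/-- The state of the exploration before a pass does not depend on the coins of that pass. -/
theorem stateAfter_update {U R : Type} (A : StreamingAlgorithm U R) (σ : Fin η → List U)
    (coins : Fin η → A.Coin) (q : Fin η) (c : A.Coin) (p : ℕ) (hp : p ≤ η) (hpq : p ≤ q) :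
    A.stateAfter (Function.update coins q c) σ p hp = A.stateAfter coins σ p hp := by
  induction p with
  | zero => rfl
  | succ p ih =>
    have hne : (⟨p, hp⟩ : Fin η) ≠ q := fun h => by
      have : p = q := congrArg Fin.val h
      omega
    simp only [StreamingAlgorithm.stateAfter, Function.update_of_ne hne]
    rw [ih (by omega) (by omega)]

/-- The hash functions `h` do not serve the guess of `x` in whose range its neighbour `y` lies. -/
def UnservedNeighbour {m : ℕ} (G : SimpleGraph (Fin n)) (ω : Sym2 (Fin n) → ℝ) (η : ℕ) (ζ : ℝ)
    (d : Fin n → ℝ≥0∞) (x y : Fin n) (h : Fin m → HashSeed n) : Prop :=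
  ∃ j, y ∈ candidates G ω η ζ d x j ∧ ¬ BFEState.Isolates h (candidates G ω η ζ d x j)

/-- The sub-range of a neighbour is unique, so there is at most one guess to fail for it. -/
theorem card_unservedNeighbour_le (hn : 2 ≤ n) (hη : 1 ≤ η) (hζ : 0 < ζ) (m : ℕ)
    (G : SimpleGraph (Fin n)) (ω : Sym2 (Fin n) → ℝ) (d : Fin n → ℝ≥0∞) (x y : Fin n) :
    (Nat.card {h : Fin m → HashSeed n // UnservedNeighbour G ω η ζ d x y h} : ℝ) ≤
      (7 / 8) ^ m * Nat.card (Fin m → HashSeed n) := by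
  by_cases hex : ∃ j, y ∈ candidates G ω η ζ d x j
  · obtain ⟨j, hj⟩ := hex
    have hiff : ∀ h : Fin m → HashSeed n, UnservedNeighbour G ω η ζ d x y h ↔
        ¬ BFEState.Isolates h (candidates G ω η ζ d x j) := by
      intro h
      refine ⟨?_, fun H => ⟨j, hj, H⟩⟩
      rintro ⟨j', hj', H⟩
      rwa [subRange_eq_of_mem hη hζ (mem_candidates.1 hj).2.2 (mem_candidates.1 hj').2.2]
    rw [Nat.card_congr (Equiv.subtypeEquivRight hiff)]
    exact card_not_isolates_le hn m ⟨y, hj⟩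
  · have : IsEmpty {h : Fin m → HashSeed n // UnservedNeighbour G ω η ζ d x y h} :=
      ⟨fun ⟨_, j, hj, _⟩ => hex ⟨j, hj⟩⟩
    rw [Nat.card_of_isEmpty]
    push_cast
    positivity

variable {G : SimpleGraph (Fin n)} {ω : Sym2 (Fin n) → ℝ} {σ : Fin η → List (Update n)}

theorem numHash_pos (hn : 2 ≤ n) (hc₁ : 0 < c₁) : 0 < numHash n c₁ := by
  have : (1 : ℝ) < n := by exact_mod_cast hn
  exact Nat.ceil_pos.2 (mul_pos hc₁ (Real.logb_pos (by norm_num) this))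

theorem sound_stateAfter (hω : ∀ e ∈ G.edgeSet, 1 ≤ ω e) (hσ : ∀ p, Describes (σ p) G ω)
    (coins : Fin η → (bellmanFord n η ζ Λ c₁ S).Coin) (p : ℕ) (hp : p ≤ η) :
    BFEState.Sound G ω S p ((bellmanFord n η ζ Λ c₁ S).stateAfter coins σ p hp) := by
  induction p with
  | zero => exact BFEState.sound_start
  | succ p ih => exact (ih (by omega)).pass hω (hσ _) _

/-- A run in which no neighbour is ever unserved succeeds. -/
theorem result_of_served (hn : 2 ≤ n) (hc₁ : 0 < c₁) (hη : 1 ≤ η) (hζ : 0 < ζ) (hζ1 : ζ ≤ 1)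
    (hΛ : 1 ≤ Λ) (hω : ∀ e ∈ G.edgeSet, 1 ≤ ω e) (hσ : ∀ p, Describes (σ p) G ω)
    (coins : Fin η → (bellmanFord n η ζ Λ c₁ S).Coin)
    (hserved : ∀ (p : Fin η) (x y : Fin n), ¬ UnservedNeighbour G ω η ζ
      (BFEState.dist ((bellmanFord n η ζ Λ c₁ S).stateAfter coins σ p p.isLt.le)) x y (coins p)) :
    ∃ dh par, (bellmanFord n η ζ Λ c₁ S).result coins σ = some (dh, par) ∧
      IsApproxBFE G ω S η ζ Λ dh par := by
  have hacc : ∀ (p : ℕ) (hp : p ≤ η), BFEState.Accurate G ω S η ζ Λ p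
      ((bellmanFord n η ζ Λ c₁ S).stateAfter coins σ p hp) := by
    intro p
    induction p with
    | zero => exact fun _ => BFEState.accurate_start Λ
    | succ p ih =>
      intro hp
      refine (ih (by omega)).pass hn (numHash_pos hn hc₁) hη hζ hζ1 hΛ hω (hσ ⟨p, hp⟩) (by omega)
        (sound_stateAfter hω hσ coins p (by omega)) (coins ⟨p, hp⟩) fun x _ j ⟨y, hy⟩ => ?_
      by_contra hI
      exact hserved ⟨p, hp⟩ x y ⟨j, hy, hI⟩
  refine ⟨_, _, ?_, BFEState.isApproxBFE_of_sound_of_accurate hη hζ hζ1 hΛ hω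
    (sound_stateAfter hω hσ coins η le_rfl) (hacc η le_rfl)⟩
  have := (hacc η le_rfl).failed
  simp only [StreamingAlgorithm.result, bellmanFord] at this ⊢
  rw [if_neg (by simp [this])]

/-- Union bound over the passes and the pairs of vertices. -/
theorem one_sub_le_resultProb (hn : 2 ≤ n) (hc₁ : 0 < c₁) (hη : 1 ≤ η) (hζ : 0 < ζ) (hζ1 : ζ ≤ 1)
    (hΛ : 1 ≤ Λ) (hω : ∀ e ∈ G.edgeSet, 1 ≤ ω e) (hσ : ∀ p, Describes (σ p) G ω) :
    1 - η * n ^ 2 * (7 / 8) ^ numHash n c₁ ≤ (bellmanFord n η ζ Λ c₁ S).resultProb σ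
      (fun out => ∃ dh par, out = some (dh, par) ∧ IsApproxBFE G ω S η ζ Λ dh par) := by
  set A := bellmanFord n η ζ Λ c₁ S
  have hfin : Finite A.Coin := A.finiteCoin
  have hne : Nonempty A.Coin := ⟨fun _ => (0, 0)⟩
  set good : (Fin η → A.Coin) → Prop := fun coins => ∃ dh par,
    A.result coins σ = some (dh, par) ∧ IsApproxBFE G ω S η ζ Λ dh par
  set bad : Fin η × Fin n × Fin n → (Fin η → A.Coin) → Prop := fun i coins =>
    UnservedNeighbour G ω η ζ (BFEState.dist (A.stateAfter coins σ i.1 i.1.isLt.le)) i.2.1 i.2.2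
      (coins i.1)
  have hbad : ∀ i, (Nat.card {coins // bad i coins} : ℝ) ≤
      (7 / 8) ^ numHash n c₁ * Nat.card (Fin η → A.Coin) := by
    rintro ⟨p, x, y⟩
    refine card_fresh_coordinate_le p (fun coins c => UnservedNeighbour G ω η ζ
      (BFEState.dist (A.stateAfter coins σ p p.isLt.le)) x y c) (fun f c c' => ?_) fun f => ?_
    · simp only [stateAfter_update A σ f p c p p.isLt.le le_rfl]
    · exact card_unservedNeighbour_le hn hη hζ _ G ω _ x y
  have hsum := (card_exists_le_sum bad).trans (Finset.sum_le_sum fun i _ => hbad i)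
  rw [Finset.sum_const, nsmul_eq_mul, Finset.card_univ, Fintype.card_prod, Fintype.card_prod,
    Fintype.card_fin, Fintype.card_fin] at hsum
  have hnot : (Nat.card {coins // ¬ good coins} : ℝ) ≤
      (Nat.card {coins // ∃ i, bad i coins} : ℝ) := by
    have himp : ∀ coins, ¬ good coins → ∃ i, bad i coins := by
      intro coins hg
      by_contra! hb
      exact hg (result_of_served hn hc₁ hη hζ hζ1 hΛ hω hσ coins fun p x y => hb (p, x, y))
    exact_mod_cast Nat.card_le_card_of_injective
      _ (Subtype.impEmbedding _ _ himp).injective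
  classical
  have htot := Nat.card_congr (Equiv.sumCompl good)
  rw [Nat.card_sum] at htot
  have htot' : (Nat.card {coins // good coins} : ℝ) + Nat.card {coins // ¬ good coins} =
      Nat.card (Fin η → A.Coin) := by exact_mod_cast htot
  have hpos : (0 : ℝ) < Nat.card (Fin η → A.Coin) := by exact_mod_cast Nat.card_pos
  change _ ≤ (Nat.card {coins // good coins} : ℝ) / Nat.card (Fin η → A.Coin)
  rw [le_div_iff₀ hpos]
  push_cast at hsum
  nlinarith

/-- With `c₁ = c + a + 2` hash functions per `log_{8/7} n` the union bound gives `n ^ (-c)`. -/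
theorem mul_pow_numHash_le (hn : 2 ≤ n) {c : ℝ} {a : ℕ} (hη : η ≤ n ^ a) :
    (η : ℝ) * n ^ 2 * (7 / 8) ^ numHash n (c + a + 2) ≤ 1 / (n : ℝ) ^ c := by
  have hn0 : (0 : ℝ) < n := by exact_mod_cast (by omega : 0 < n)
  have hη' : (η : ℝ) ≤ n ^ a := by exact_mod_cast hη
  have hpow : (7 / 8 : ℝ) ^ numHash n (c + a + 2) ≤ ((n : ℝ) ^ (c + a + 2))⁻¹ := by
    rw [← Real.rpow_natCast]
    refine (Real.rpow_le_rpow_of_exponent_ge (by norm_num) (by norm_num)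
      (Nat.le_ceil ((c + a + 2) * Real.logb (8 / 7) n))).trans (le_of_eq ?_)
    rw [show (7 / 8 : ℝ) = (8 / 7)⁻¹ by norm_num, Real.inv_rpow (by norm_num), mul_comm,
      Real.rpow_mul (by norm_num), Real.rpow_logb (by norm_num) (by norm_num) hn0]
  calc (η : ℝ) * n ^ 2 * (7 / 8) ^ numHash n (c + a + 2)
      ≤ n ^ a * n ^ 2 * ((n : ℝ) ^ (c + a + 2))⁻¹ := by gcongr
    _ = 1 / (n : ℝ) ^ c := by
      rw [show c + a + 2 = c + (a : ℝ) + ((2 : ℕ) : ℝ) by norm_num, Real.rpow_add hn0,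
        Real.rpow_add hn0, Real.rpow_natCast, Real.rpow_natCast]
      field_simp

/-! ### Space -/

theorem numBits_le {x B : ℝ} (hB : 1 ≤ B) (hx : |x| ≤ B) :
    (BFEState.numBits x : ℝ) ≤ Real.logb 2 B + 3 := by
  have hsize : (Nat.size ⌈B⌉₊ : ℝ) ≤ Real.logb 2 B + 2 := by
    have hk : 0 < Nat.size ⌈B⌉₊ := Nat.size_pos.2 (Nat.ceil_pos.2 (by linarith))
    obtain ⟨q, hq⟩ : ∃ q, Nat.size ⌈B⌉₊ = q + 1 := ⟨_, (Nat.succ_pred_eq_of_pos hk).symm⟩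
    have h1 : 2 ^ q ≤ ⌈B⌉₊ := Nat.lt_size.1 (by omega)
    have h2 : (2 : ℝ) ^ q ≤ 2 * B := by
      have h3 : (2 : ℝ) ^ q ≤ ⌈B⌉₊ := by exact_mod_cast h1
      linarith [Nat.ceil_lt_add_one (show 0 ≤ B by linarith)]
    have h3 : (q : ℝ) ≤ Real.logb 2 (2 * B) := by
      rwa [Real.le_logb_iff_rpow_le one_lt_two (by linarith), Real.rpow_natCast]
    rw [Real.logb_mul (by norm_num) (by linarith), Real.logb_self_eq_one one_lt_two] at h3
    rw [hq]
    push_cast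
    linarith
  have hmono : (Nat.size ⌈|x|⌉₊ : ℝ) ≤ Nat.size ⌈B⌉₊ := by
    exact_mod_cast Nat.size_le_size (Nat.ceil_le_ceil hx)
  rw [BFEState.numBits]
  push_cast
  linarith

/-- The content of a slot of a graph on `n` vertices after `N` updates with values at most `D`. -/
structure Slot.IsBounded (n N : ℕ) (D : ℝ) (t : Slot) : Prop where
  count : |(t.xCount : ℝ)| ≤ N
  dist : |t.xDist| ≤ N * D
  name : t.xName < 2 ^ logn n

theorem Slot.isBounded_empty (n : ℕ) (D : ℝ) : Slot.empty.IsBounded n 0 D :=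
  ⟨by simp [Slot.empty], by simp [Slot.empty], by simp [Slot.empty]⟩

theorem Slot.IsBounded.mono {n N N' : ℕ} {D : ℝ} (hD : 0 ≤ D) {t : Slot} (h : t.IsBounded n N D)
    (hN : N ≤ N') : t.IsBounded n N' D := by
  have hN' : (N : ℝ) ≤ N' := by exact_mod_cast hN
  exact ⟨h.count.trans hN', h.dist.trans (by gcongr), h.name⟩

namespace BFEState

variable {n m r η : ℕ} {ζ D : ℝ} {S : Finset (Fin n)}
  {σ : List (Update n)} {G : SimpleGraph (Fin n)} {ω : Sym2 (Fin n) → ℝ}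

theorem isBounded_read (hη : 1 ≤ η) (hζ : 0 < ζ) (hD : (1 + zeta' η ζ) ^ r ≤ D)
    (s : BFEState n m r) (u : Update n) {x : Fin n} {j : Fin r} {i : Fin m}
    {k : Fin (logn n + 1)} {N : ℕ} (h : (s.slots x j i k).IsBounded n N D) :
    ((read η ζ S s u).slots x j i k).IsBounded n (N + 1) D := by
  have hq := one_lt_one_add_zeta' hη hζ
  have hD0 : 0 ≤ D := le_trans (by positivity) hD
  have hsame := h.mono hD0 (Nat.le_succ N)
  unfold read
  simp only
  split_ifs with hxe hcond
  · generalize Sym2.Mem.other hxe = y at hcond ⊢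
    obtain ⟨-, -, hmem, -⟩ := hcond
    have h1 := one_le_of_mem_subRange hη hζ hmem
    have h2 : (s.dist y).toReal + u.weight ≤ D :=
      (le_pow_of_mem_subRange hmem).trans ((pow_le_pow_right₀ hq.le j.isLt).trans hD)
    have hsign : |((u.sign : ℤ) : ℝ)| = 1 := by
      rcases Int.units_eq_one_or u.sign with hu | hu <;> simp [hu]
    refine ⟨?_, ?_, ?_⟩
    · simp only
      push_cast
      exact (abs_add_le _ _).trans (by linarith [h.count])
    · simp only
      refine (abs_add_le _ _).trans ?_
      rw [abs_mul, hsign, mul_one,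
        abs_of_pos (a := (s.dist y).toReal + u.weight) (by linarith)]
      push_cast
      linarith [h.dist]
    · exact Nat.xor_lt_two_pow h.name (y.isLt.trans_le (Nat.le_pow_clog one_lt_two n))
  · exact hsame
  · exact hsame

theorem isBounded_foldl_read (hη : 1 ≤ η) (hζ : 0 < ζ) (hD : (1 + zeta' η ζ) ^ r ≤ D)
    (σ : List (Update n)) (s : BFEState n m r) {x : Fin n} {j : Fin r} {i : Fin m}
    {k : Fin (logn n + 1)} {N : ℕ} (h : (s.slots x j i k).IsBounded n N D) :
    ((σ.foldl (read η ζ S) s).slots x j i k).IsBounded n (N + σ.length) D := by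
  induction σ generalizing s N with
  | nil => exact h
  | cons u σ ih =>
    have := ih (read η ζ S s u) (isBounded_read hη hζ hD s u h)
    rw [List.length_cons, show N + (σ.length + 1) = N + 1 + σ.length by omega]
    exact this

/-- All numbers in the state are bounded: the estimates by `D`, and the slots as after at most `M`
updates. -/
structure IsBounded (M : ℕ) (D : ℝ) (s : BFEState n m r) : Prop where
  dist : ∀ v, (s.dist v).toReal ≤ D
  shadow : ∀ v, (s.shadow v).toReal ≤ D
  slots : ∀ x j i k, (s.slots x j i k).IsBounded n M D

theorem isBounded_start (M : ℕ) (hD : 0 ≤ D) : IsBounded M D (start n m r S) where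
  dist v := by by_cases hv : v ∈ S <;> simp [start, hv, hD]
  shadow v := by by_cases hv : v ∈ S <;> simp [start, hv, hD]
  slots _ _ _ _ := (Slot.isBounded_empty n D).mono hD (Nat.zero_le M)

theorem IsBounded.during (hη : 1 ≤ η) (hζ : 0 < ζ) (hD : (1 + zeta' η ζ) ^ r ≤ D) {M : ℕ}
    (hσ : σ.length ≤ M) {s : BFEState n m r} (hs : IsBounded M D s) (h : Fin m → HashSeed n) :
    IsBounded M D (σ.foldl (read η ζ S) (beginPhase h s)) := by
  have hq := one_lt_one_add_zeta' hη hζ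
  have hD0 : 0 ≤ D := le_trans (by positivity) hD
  obtain ⟨h1, h2, -, -, -⟩ := foldl_read_fields (η := η) (ζ := ζ) (S := S) σ (beginPhase h s)
  refine ⟨fun v => ?_, fun v => ?_, fun x j i k => ?_⟩
  · rw [h1]
    exact hs.dist v
  · rw [h2]
    exact hs.dist v
  · refine (isBounded_foldl_read hη hζ hD σ (beginPhase h s) (N := 0)
      (Slot.isBounded_empty n D)).mono hD0 ?_
    omega

theorem slots_endPhase (S : Finset (Fin n)) (s : BFEState n m r) :
    (endPhase S s).slots = s.slots := by
  unfold endPhase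
  split_ifs <;> rfl

/-- New estimates come from a sub-range and thus never exceed the search range, whatever the hash
functions are. -/
theorem IsBounded.pass (hη : 1 ≤ η) (hζ : 0 < ζ) (hD : (1 + zeta' η ζ) ^ r ≤ D) {M : ℕ}
    (hσ : σ.length ≤ M) (hσG : Describes σ G ω) {s : BFEState n m r} (hs : IsBounded M D s)
    (h : Fin m → HashSeed n) : IsBounded M D (pass η ζ S σ s h) := by
  have hq := one_lt_one_add_zeta' hη hζ
  have hdist : ∀ v, ((BFEState.pass η ζ S σ s h).dist v).toReal ≤ D := by
    intro v
    rcases pass_cases (η := η) (ζ := ζ) (S := S) hσG s h v with h | ⟨-, j, y, hy, h1, -, -⟩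
    · rw [h.1]
      exact hs.dist v
    · have hmem := (mem_candidates.1 hy).2.2
      rw [h1, ENNReal.toReal_ofReal (by linarith [one_le_of_mem_subRange hη hζ hmem])]
      exact (le_pow_of_mem_subRange hmem).trans ((pow_le_pow_right₀ hq.le j.isLt).trans hD)
  refine ⟨hdist, ?_, ?_⟩
  · rw [pass_shadow]
    exact hdist
  · unfold BFEState.pass
    rw [slots_endPhase]
    exact (hs.during (S := S) hη hζ hD hσ h).slots

end BFEState

section Logarithms

variable {n η : ℕ} {ζ Λ : ℝ}

theorem one_le_logb_two {x : ℝ} (hx : 2 ≤ x) : 1 ≤ Real.logb 2 x := by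
  rw [Real.le_logb_iff_rpow_le one_lt_two (by linarith), Real.rpow_one]
  exact hx

theorem logn_le (hn : 2 ≤ n) : (logn n : ℝ) ≤ 2 * Real.logb 2 n := by
  have hl := one_le_logb_two (x := n) (by exact_mod_cast hn)
  have hpos : 0 < logn n := Nat.clog_pos one_lt_two hn
  obtain ⟨q, hq⟩ : ∃ q, logn n = q + 1 := ⟨logn n - 1, by omega⟩
  have h1 : 2 ^ (logn n).pred < n := Nat.pow_pred_clog_lt_self one_lt_two (by omega)
  rw [hq, Nat.pred_succ] at h1
  have h2 : (q : ℝ) ≤ Real.logb 2 n := by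
    rw [Real.le_logb_iff_rpow_le one_lt_two (by positivity), Real.rpow_natCast]
    exact_mod_cast h1.le
  rw [hq]
  push_cast
  linarith

theorem numHash_le (hn : 2 ≤ n) {c₁ : ℝ} (hc₁ : 0 < c₁) :
    (numHash n c₁ : ℝ) ≤ (c₁ * Real.logb (8 / 7) 2 + 1) * Real.logb 2 n := by
  have hl := one_le_logb_two (x := n) (by exact_mod_cast hn)
  have hmul : Real.logb (8 / 7) 2 * Real.logb 2 n = Real.logb (8 / 7) n :=
    Real.mul_logb (by norm_num) (by norm_num) (by norm_num)
  have hnonneg : 0 ≤ Real.logb (8 / 7) (n : ℝ) := by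
    rw [← hmul]
    exact mul_nonneg (Real.logb_nonneg (by norm_num) (by norm_num)) (by linarith)
  have := Nat.ceil_lt_add_one (mul_nonneg hc₁.le hnonneg)
  rw [numHash]
  nlinarith

theorem numRanges_le (hη : 1 ≤ η) (hζ : 0 < ζ) (hζ1 : ζ ≤ 1) (hΛ : 1 ≤ Λ) :
    (numRanges η ζ Λ : ℝ) ≤ 5 * (η / ζ) * Real.logb 2 (2 * Λ) := by
  have hη' : (1 : ℝ) ≤ η := by exact_mod_cast hη
  have hL := one_le_logb_two (x := 2 * Λ) (by linarith)
  have hq := one_lt_one_add_zeta' hη hζ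
  have he : 1 ≤ η / ζ := by
    rw [le_div_iff₀ hζ]
    linarith
  have hz : 0 < zeta' η ζ := by linarith
  have hz1 : zeta' η ζ ≤ 1 := by
    unfold zeta'
    rw [div_le_one (by positivity)]
    linarith
  -- `log₂ (1 + ζ') ≥ ln (1 + ζ') ≥ ζ' / (1 + ζ') ≥ ζ' / 2`
  have hlog : zeta' η ζ / 2 ≤ Real.log (1 + zeta' η ζ) := by
    refine le_trans ?_ (Real.one_sub_inv_le_log_of_pos (by linarith))
    have : 1 - (1 + zeta' η ζ)⁻¹ = zeta' η ζ / (1 + zeta' η ζ) := by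
      field_simp
      ring
    rw [this]
    gcongr
    linarith
  have hlogΛ : 0 ≤ Real.log (2 * Λ) := Real.log_nonneg (by linarith)
  have hlog2 : Real.log (2 * Λ) ≤ Real.logb 2 (2 * Λ) := by
    rw [Real.logb, le_div_iff₀ (Real.log_pos one_lt_two)]
    nlinarith [Real.log_two_lt_d9]
  have hle : Real.logb (1 + zeta' η ζ) (2 * Λ) ≤ 4 * (η / ζ) * Real.logb 2 (2 * Λ) := by
    calc Real.logb (1 + zeta' η ζ) (2 * Λ)
        = Real.log (2 * Λ) / Real.log (1 + zeta' η ζ) := rfl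
      _ ≤ Real.log (2 * Λ) / (zeta' η ζ / 2) := by gcongr
      _ = 4 * (η / ζ) * Real.log (2 * Λ) := by
        unfold zeta'
        field_simp
        ring
      _ ≤ _ := by gcongr
  have hnonneg : 0 ≤ Real.logb (1 + zeta' η ζ) (2 * Λ) := Real.logb_nonneg hq (by linarith)
  have := Nat.ceil_lt_add_one hnonneg
  rw [numRanges]
  nlinarith

end Logarithms

variable {n η : ℕ} {ζ Λ c₁ : ℝ} {S : Finset (Fin n)}

theorem estimateBits_le (hΛ : 1 ≤ Λ) {d : ℝ≥0∞} (hd : d.toReal ≤ 4 * Λ) :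
    (BFEState.estimateBits d : ℝ) ≤ Real.logb 2 (2 * Λ) + 5 := by
  have h := numBits_le (x := d.toReal) (B := 4 * Λ) (by linarith)
    (by rwa [abs_of_nonneg ENNReal.toReal_nonneg])
  rw [show 4 * Λ = 2 * (2 * Λ) by ring, Real.logb_mul (by norm_num) (by linarith),
    Real.logb_self_eq_one one_lt_two] at h
  rw [BFEState.estimateBits]
  push_cast
  linarith

theorem slotBits_le (hn : 2 ≤ n) (hΛ : 1 ≤ Λ) {a : ℕ} {t : Slot}
    (ht : t.IsBounded n (n ^ a) (4 * Λ)) : (BFEState.slotBits t : ℝ) ≤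
      (2 * a + 12) * (Real.logb 2 n + Real.logb 2 (2 * Λ)) := by
  have hl := one_le_logb_two (x := n) (by exact_mod_cast hn)
  have hL := one_le_logb_two (x := 2 * Λ) (by linarith)
  have hn1 : (1 : ℝ) ≤ n := by exact_mod_cast (by omega : 1 ≤ n)
  have hna : (1 : ℝ) ≤ (n : ℝ) ^ a := one_le_pow₀ hn1
  have hcount := ht.count
  have hdist := ht.dist
  push_cast at hcount hdist
  have h1 := numBits_le hna hcount
  have h2 := numBits_le (B := (n : ℝ) ^ a * (4 * Λ)) (by nlinarith) hdist
  have h3 := numBits_le (x := (t.xName : ℝ)) (B := 2 ^ logn n) (one_le_pow₀ one_le_two) (by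
    rw [abs_of_nonneg (Nat.cast_nonneg _)]
    exact_mod_cast ht.name.le)
  rw [Real.logb_mul (by positivity) (by linarith), show 4 * Λ = 2 * (2 * Λ) by ring,
    Real.logb_mul (by norm_num) (by linarith), Real.logb_self_eq_one one_lt_two,
    Real.logb_pow] at h2
  rw [Real.logb_pow] at h1
  rw [Real.logb_pow, Real.logb_self_eq_one one_lt_two, mul_one] at h3
  have h4 := logn_le hn
  rw [BFEState.slotBits]
  push_cast
  have ha : (0 : ℝ) ≤ a := Nat.cast_nonneg a
  nlinarith [mul_nonneg ha (by linarith : 0 ≤ Real.logb 2 (2 * Λ))]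

/-- The constant of the space bound. -/
def spaceConst (c₁ : ℝ) (a : ℕ) : ℝ :=
  15 + (c₁ * Real.logb (8 / 7) 2 + 1) * (4 + 15 * (2 * a + 12))

theorem spaceConst_pos (hc₁ : 0 < c₁) (a : ℕ) : 0 < spaceConst c₁ a := by
  have : 0 ≤ Real.logb (8 / 7 : ℝ) 2 := Real.logb_nonneg (by norm_num) (by norm_num)
  unfold spaceConst
  positivity

theorem bits_le_of_isBounded (hn : 2 ≤ n) (hc₁ : 0 < c₁) (hη : 1 ≤ η) (hζ : 0 < ζ) (hζ1 : ζ ≤ 1)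
    (hΛ : 1 ≤ Λ) {a : ℕ} {s : BFEState n (numHash n c₁) (numRanges η ζ Λ)}
    (hs : s.IsBounded (n ^ a) (4 * Λ)) :
    (s.bits : ℝ) ≤ spaceConst c₁ a * (n * (η / ζ) * Real.logb 2 n ^ 2 * Real.logb 2 (2 * Λ) *
      (Real.logb 2 n + Real.logb 2 (2 * Λ))) := by
  have hl := one_le_logb_two (x := n) (by exact_mod_cast hn)
  have hL := one_le_logb_two (x := 2 * Λ) (by linarith)
  have hlog := logn_le hn
  have hm := numHash_le hn hc₁
  have hr := numRanges_le hη hζ hζ1 hΛ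
  have hn1 : (1 : ℝ) ≤ n := by exact_mod_cast (by omega : 1 ≤ n)
  have he : 1 ≤ η / ζ := by
    rw [le_div_iff₀ hζ]
    have : (1 : ℝ) ≤ η := by exact_mod_cast hη
    linarith
  have hμ : 1 ≤ c₁ * Real.logb (8 / 7) 2 + 1 := by
    have : 0 ≤ Real.logb (8 / 7 : ℝ) 2 := Real.logb_nonneg (by norm_num) (by norm_num)
    nlinarith
  have hest : ∀ v, (BFEState.estimateBits (s.dist v) : ℝ) + BFEState.estimateBits (s.shadow v) +
      (logn n + 1) + 1 ≤ 14 * (Real.logb 2 n + Real.logb 2 (2 * Λ)) := by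
    intro v
    have h1 := estimateBits_le hΛ (hs.dist v)
    have h2 := estimateBits_le hΛ (hs.shadow v)
    linarith
  have hslot := fun x j i k => slotBits_le hn hΛ (hs.slots x j i k)
  have hbits : (s.bits : ℝ) ≤ n * (14 * (Real.logb 2 n + Real.logb 2 (2 * Λ))) +
      numHash n c₁ * (2 * logn n) + n * (numRanges η ζ Λ * (numHash n c₁ * ((logn n + 1) *
        ((2 * a + 12) * (Real.logb 2 n + Real.logb 2 (2 * Λ)))))) + 1 := by
    rw [BFEState.bits]
    push_cast
    gcongr
    · refine (Finset.sum_le_sum fun v _ => hest v).trans (le_of_eq ?_)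
      simp
    · refine (Finset.sum_le_sum fun x _ => Finset.sum_le_sum fun j _ => Finset.sum_le_sum fun i _ =>
        Finset.sum_le_sum fun k _ => hslot x j i k).trans (le_of_eq ?_)
      simp
  refine hbits.trans ?_
  unfold spaceConst
  generalize Real.logb 2 (n : ℝ) = l at *
  generalize Real.logb 2 (2 * Λ) = L at *
  generalize c₁ * Real.logb (8 / 7) 2 + 1 = μ at *
  generalize (η : ℝ) / ζ = e at *
  have hlL : 0 ≤ l + L := by linarith
  have ha : (0 : ℝ) ≤ a := Nat.cast_nonneg a
  -- Each of the four summands is at most a constant times `n e l² L (l + L)`.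
  have hB1 : 1 ≤ e * l ^ 2 * L :=
    one_le_mul_of_one_le_of_one_le (one_le_mul_of_one_le_of_one_le he (one_le_pow₀ hl)) hL
  have hB2 : l ^ 2 ≤ n * e * l ^ 2 * L * (l + L) := by
    have h1 : 1 ≤ (n * e) * (L * (l + L)) := one_le_mul_of_one_le_of_one_le
      (one_le_mul_of_one_le_of_one_le hn1 he)
      (one_le_mul_of_one_le_of_one_le hL (by linarith))
    nlinarith [mul_le_mul_of_nonneg_left h1 (sq_nonneg l)]
  have hB3 : (1 : ℝ) ≤ n * e * l ^ 2 * L * (l + L) := (one_le_pow₀ hl).trans hB2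
  have hB4 : n * (14 * (l + L)) ≤ 14 * (n * e * l ^ 2 * L * (l + L)) := by
    have : 0 ≤ n * (14 * (l + L)) := by positivity
    nlinarith [mul_le_mul_of_nonneg_left hB1 this]
  have hB5 : numHash n c₁ * (2 * (logn n : ℝ)) ≤ μ * 4 * (n * e * l ^ 2 * L * (l + L)) := by
    calc numHash n c₁ * (2 * (logn n : ℝ)) ≤ (μ * l) * (2 * (2 * l)) := by gcongr
      _ = μ * 4 * l ^ 2 := by ring
      _ ≤ _ := by gcongr
  have hB6 : (n : ℝ) * (numRanges η ζ Λ * (numHash n c₁ * ((logn n + 1) *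
      ((2 * a + 12) * (l + L))))) ≤ μ * (15 * (2 * a + 12)) * (n * e * l ^ 2 * L * (l + L)) := by
    calc (n : ℝ) * (numRanges η ζ Λ * (numHash n c₁ * ((logn n + 1) *
          ((2 * a + 12) * (l + L)))))
        ≤ n * ((5 * e * L) * ((μ * l) * ((3 * l) * ((2 * a + 12) * (l + L))))) := by
          have : (logn n : ℝ) + 1 ≤ 3 * l := by linarith
          gcongr
      _ = _ := by ring
  nlinarith

/-- The space bound holds for all coins: registers receive at most `n ^ a` summands of size at most
`4 Λ` per pass. -/
theorem spaceAtMost_bellmanFord (hn : 2 ≤ n) (hc₁ : 0 < c₁) (hη : 1 ≤ η) (hζ : 0 < ζ)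
    (hζ1 : ζ ≤ 1) (hΛ : 1 ≤ Λ) {a : ℕ} {G : SimpleGraph (Fin n)} {ω : Sym2 (Fin n) → ℝ}
    {σ : Fin η → List (Update n)} (hσ : ∀ p, Describes (σ p) G ω ∧ (σ p).length ≤ n ^ a)
    (coins : Fin η → (bellmanFord n η ζ Λ c₁ S).Coin) :
    (bellmanFord n η ζ Λ c₁ S).SpaceAtMost coins σ
      (spaceConst c₁ a * (n * (η / ζ) * Real.logb 2 n ^ 2 * Real.logb 2 (2 * Λ) *
        (Real.logb 2 n + Real.logb 2 (2 * Λ)))) := by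
  have hD := pow_numRanges_le hη hζ hζ1 hΛ
  have hafter : ∀ (p : ℕ) (hp : p ≤ η), BFEState.IsBounded (n ^ a) (4 * Λ)
      ((bellmanFord n η ζ Λ c₁ S).stateAfter coins σ p hp) := by
    intro p
    induction p with
    | zero => exact fun _ => BFEState.isBounded_start _ (by linarith)
    | succ p ih =>
      exact fun hp => (ih (by omega)).pass hη hζ hD (hσ ⟨p, hp⟩).2 (hσ ⟨p, hp⟩).1 (coins ⟨p, hp⟩)
  refine ⟨fun p hp => bits_le_of_isBounded hn hc₁ hη hζ hζ1 hΛ (hafter p hp), fun p i => ?_⟩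
  refine bits_le_of_isBounded hn hc₁ hη hζ hζ1 hΛ
    ((hafter p p.isLt.le).during (S := S) hη hζ hD ?_ (coins p))
  exact (List.length_take_le' _ _).trans (hσ p).2

end DynStream

end

theorem mainTheorem7 (c : ℝ) (hc : 0 < c) (a : ℕ) :
    ∃ c₁ C : ℝ, 0 < c₁ ∧ 0 < C ∧
      ∀ (n : ℕ) (_ : 2 ≤ n) (G : SimpleGraph (Fin n)) (ω : Sym2 (Fin n) → ℝ)
        (_ : ∀ e ∈ G.edgeSet, 1 ≤ ω e)
        (Λ : ℝ) (_ : 1 ≤ Λ) (_ : DynStream.aspectRatio G ω ≤ ENNReal.ofReal Λ)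
        (S : Finset (Fin n)) (η : ℕ) (_ : 1 ≤ η) (_ : η ≤ n ^ a)
        (ζ : ℝ) (_ : 0 < ζ) (_ : ζ ≤ 1)
        (σ : Fin η → List (DynStream.Update n))
        (_ : ∀ p, DynStream.Describes (σ p) G ω ∧ (σ p).length ≤ n ^ a),
        1 - 1 / (n : ℝ) ^ c ≤
            (DynStream.bellmanFord n η ζ Λ c₁ S).resultProb σ
              (fun out => ∃ dh par, out = some (dh, par) ∧
                DynStream.IsApproxBFE G ω S η ζ Λ dh par) ∧
          ∀ coins : Fin η → (DynStream.bellmanFord n η ζ Λ c₁ S).Coin,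
            (DynStream.bellmanFord n η ζ Λ c₁ S).SpaceAtMost coins σ
              (C * (n * (η / ζ) * Real.logb 2 n ^ 2 * Real.logb 2 (2 * Λ) *
                (Real.logb 2 n + Real.logb 2 (2 * Λ)))) := by
  have hc₁ : 0 < c + a + 2 := by positivity
  refine ⟨c + a + 2, DynStream.spaceConst (c + a + 2) a, hc₁, DynStream.spaceConst_pos hc₁ a, ?_⟩
  intro n hn G ω hω Λ hΛ _ S η hη hηn ζ hζ hζ1 σ hσ
  refine ⟨?_, DynStream.spaceAtMost_bellmanFord hn hc₁ hη hζ hζ1 hΛ hσ⟩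
  have h1 := DynStream.one_sub_le_resultProb (S := S) hn hc₁ hη hζ hζ1 hΛ hω fun p => (hσ p).1
  have h2 := DynStream.mul_pow_numHash_le hn (c := c) hηn
  linarith
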